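/- Let $p$ be a prime number, let $G$ be a pro-$p$ group, and let $\theta\colon G\to\mathbb{Z}_p^\times$ be a continuous homomorphism whose image is a torsion-free group; that is, $\mathcal{G}=(G,\theta)$ is a torsion-free cyclotomic pro-$p$ pair. ($G$ need not be finitely generated.) Let $\mathbb{Z}_p(1)$ be the additive group $\mathbb{Z}_p$ with the $G$-action $g\cdot z=\theta(g)z$. A continuous 1-cocycle $c\colon G\to\mathbb{Z}_p(1)$ is a continuous map with $c(g_1g_2)=c(g_1)+\theta(g_1)c(g_2)$ for all $g_1,g_2\in G$. Let $$K(\mathcal{G})=\overline{\left\langle\, h^{-\theta(g)}\,g\,h\,g^{-1}\;\middle|\; g\in G,\ h\in\operatorname{Ker}(\theta)\,\right\rangle}$$ be the closed subgroup of $G$ generated by these elements. The pair $\mathcal{G}$ is called Kummerian if for every $n\ge 1$ the map $H^1(G,\mathbb{Z}_p(1)/p^n)\to H^1(G,\mathbb{Z}_p(1)/p)$ in continuous cohomology, induced by the canonical epimorphism $\mathbb{Z}_p(1)/p^n\to\mathbb{Z}_p(1)/p$, is surjective. Then $\mathcal{G}$ is Kummerian if and only if $$K(\mathcal{G})=\bigcap_{c}c^{-1}(\{0\}),$$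 where $c$ runs through all continuous 1-cocycles $c\colon G\to\mathbb{Z}_p(1)$ which factor through a topologically finitely generated quotient $G/N$ of $G$, with $N$ a closed normal subgroup. -/

import Mathlib

namespace CyclotomicProP

open Filter Topology

/-- A profinite group (compact, totally disconnected topological group) is a pro-`p` group if each
of its quotients by an open normal subgroup is a `p`-group. -/
def IsProP (p : ℕ) (G : Type*) [Group G] [TopologicalSpace G] : Prop :=
  ∀ U : Subgroup G, U.Normal → IsOpen (U : Set G) → ∀ g : G, ∃ k : ℕ, g ^ p ^ k ∈ U

/-- A topological group is finitely generated (in the topological sense) if some finite subset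
generates a dense subgroup. -/
def TopologicallyFG (H : Type*) [Group H] [TopologicalSpace H] : Prop :=
  ∃ S : Set H, S.Finite ∧ Dense (Subgroup.closure S : Set H)

section Power

variable {p : ℕ} [Fact p.Prime] {G : Type*} [Group G] [TopologicalSpace G]

/-- The power `h ^ a` of an element `h` of a pro-`p` group with a `p`-adic integer exponent `a`:
the limit of the powers `h ^ aₙ`, where `aₙ` is the natural number below `p ^ n` that is congruent
to `a` modulo `p ^ n`. It exists by `tendsto_padicPow`. -/
noncomputable def padicPow (h : G) (a : ℤ_[p]) : G :=
  haveI : Nonempty G := ⟨1⟩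
  limUnder atTop (fun n : ℕ => h ^ a.appr n)

theorem tendsto_padicPow [IsTopologicalGroup G] [CompactSpace G] [TotallyDisconnectedSpace G]
    (hG : IsProP p G) (h : G) (a : ℤ_[p]) :
    Tendsto (fun n : ℕ => h ^ a.appr n) atTop (𝓝 (padicPow h a)) := by
  have : Nonempty G := ⟨1⟩
  refine tendsto_nhds_limUnder ?_
  obtain ⟨x, hx⟩ := exists_clusterPt_of_compactSpace (map (fun n : ℕ => h ^ a.appr n) atTop)
  have hx : MapClusterPt x atTop (fun n : ℕ => h ^ a.appr n) := hx
  refine ⟨x, fun V hV => ?_⟩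
  have hV' : (fun y => x * y) ⁻¹' V ∈ 𝓝 (1 : G) :=
    (continuous_const_mul x).continuousAt.preimage_mem_nhds (by simpa using hV)
  obtain ⟨W, hWV, hW, h1⟩ := mem_nhds_iff.1 hV'
  obtain ⟨U, hU⟩ := ProfiniteGrp.exist_openNormalSubgroup_sub_open_nhds_of_one hW h1
  obtain ⟨k, hk⟩ := hG U.toSubgroup inferInstance U.isOpen' h
  have hmod : ∀ n, k ≤ n → (h ^ a.appr k)⁻¹ * h ^ a.appr n ∈ U.toSubgroup := by
    intro n hn
    obtain ⟨t, ht⟩ := a.dvd_appr_sub_appr k n hn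
    have : a.appr n = a.appr k + p ^ k * t := by
      have := a.appr_mono hn
      omega
    rw [this, pow_add, inv_mul_cancel_left, pow_mul]
    exact pow_mem hk t
  have hxU : (fun y => x⁻¹ * y) ⁻¹' (U : Set G) ∈ 𝓝 x :=
    (continuous_const_mul x⁻¹).continuousAt.preimage_mem_nhds (by
      rw [inv_mul_cancel]
      exact U.isOpen'.mem_nhds (one_mem U.toSubgroup))
  obtain ⟨m, hmU, hm⟩ := ((hx.frequently hxU).and_eventually (eventually_ge_atTop k)).exists
  rw [mem_map]
  filter_upwards [eventually_ge_atTop k] with n hn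
  have h2 : x⁻¹ * h ^ a.appr n ∈ U.toSubgroup := by
    have := mul_mem (mul_mem (show x⁻¹ * h ^ a.appr m ∈ U.toSubgroup from hmU)
      (inv_mem (hmod m hm))) (hmod n hn)
    simpa [mul_assoc] using this
  have := hWV (hU h2)
  simpa using this

end Power

section Pair

/-! A cyclotomic pro-`p` pair is a pro-`p` group `G` with an orientation, that is, a continuous
homomorphism `θ : G → ℤ_pˣ`. -/

variable {p : ℕ} [Fact p.Prime] {G : Type*} [Group G] [TopologicalSpace G]

/-- The pair `(G, θ)` is torsion-free if the image of `θ` is a torsion-free group. -/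
def IsTorsionFree (θ : G →ₜ* ℤ_[p]ˣ) : Prop :=
  ∀ u ∈ Set.range θ, ∀ n : ℕ, 1 ≤ n → u ^ n = 1 → u = 1

/-- The subgroup `K(G, θ)`, (topologically) generated by the elements `h ^ (-θ(g)) * g * h * g⁻¹`
with `g ∈ G` and `h ∈ Ker θ`. -/
noncomputable def K [IsTopologicalGroup G] (θ : G →ₜ* ℤ_[p]ˣ) : Subgroup G :=
  (Subgroup.closure {x : G | ∃ g h : G, θ h = 1 ∧
    x = padicPow h (-(θ g : ℤ_[p])) * g * h * g⁻¹}).topologicalClosure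

section Cohomology

variable (θ : G →ₜ* ℤ_[p]ˣ)
variable (M : Type*) [AddCommGroup M] [Module ℤ_[p] M] [TopologicalSpace M]

/-- The continuous 1-cocycles `c : G → M`, where `g ∈ G` acts on the topological `ℤ_p`-module `M`
as multiplication by `θ g`. For `M = ℤ_p` this `G`-module is `ℤ_p(1)`, for `M = ℤ_p / p ^ n` it is
`ℤ_p(1) / p ^ n`. -/
def cocycles [IsTopologicalAddGroup M] : AddSubgroup (G → M) where
  carrier := {c | Continuous c ∧ ∀ g₁ g₂ : G, c (g₁ * g₂) = c g₁ + (θ g₁ : ℤ_[p]) • c g₂}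
  zero_mem' := ⟨continuous_const, fun _ _ => by simp⟩
  add_mem' := by
    rintro c d ⟨hc, hc'⟩ ⟨hd, hd'⟩
    refine ⟨hc.add hd, fun g₁ g₂ => ?_⟩
    simp only [Pi.add_apply, hc', hd', smul_add]
    abel
  neg_mem' := by
    rintro c ⟨hc, hc'⟩
    refine ⟨hc.neg, fun g₁ g₂ => ?_⟩
    simp only [Pi.neg_apply, hc', smul_neg]
    abel

/-- The 1-coboundaries `g ↦ g • m - m`. -/
def coboundaries : AddSubgroup (G → M) where
  carrier := {c | ∃ m : M, ∀ g : G, c g = (θ g : ℤ_[p]) • m - m}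
  zero_mem' := ⟨0, fun _ => by simp⟩
  add_mem' := by
    rintro c d ⟨m, hm⟩ ⟨n, hn⟩
    refine ⟨m + n, fun g => ?_⟩
    simp only [Pi.add_apply, hm, hn, smul_add]
    abel
  neg_mem' := by
    rintro c ⟨m, hm⟩
    refine ⟨-m, fun g => ?_⟩
    simp only [Pi.neg_apply, hm, smul_neg]
    abel

/-- The first continuous cohomology group `H¹(G, M)`: continuous 1-cocycles modulo
1-coboundaries. -/
abbrev H1 [IsTopologicalAddGroup M] : Type _ :=
  cocycles θ M ⧸ (coboundaries θ M).addSubgroupOf (cocycles θ M)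

variable {M} {N : Type*} [AddCommGroup N] [Module ℤ_[p] N] [TopologicalSpace N]

/-- The map on continuous 1-cocycles induced by a continuous `ℤ_p`-linear map of coefficients. -/
noncomputable def cocyclesMap [IsTopologicalAddGroup M] [IsTopologicalAddGroup N] (f : M →L[ℤ_[p]] N) :
    cocycles θ M →+ cocycles θ N where
  toFun c := ⟨fun g => f (c.1 g), f.continuous.comp c.2.1, fun g₁ g₂ => by
    simp [c.2.2 g₁ g₂]⟩
  map_zero' := by ext g; simp
  map_add' c d := by ext g; simp

/-- The map `H¹(G, M) → H¹(G, N)` induced by a continuous `ℤ_p`-linear map of coefficients. -/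
noncomputable def H1map [IsTopologicalAddGroup M] [IsTopologicalAddGroup N] (f : M →L[ℤ_[p]] N) :
    H1 θ M →+ H1 θ N :=
  QuotientAddGroup.map _ _ (cocyclesMap θ f) (by
    rintro c ⟨m, hm⟩
    refine ⟨f m, fun g => ?_⟩
    have hm : c.1 g = (θ g : ℤ_[p]) • m - m := hm g
    simp [cocyclesMap, hm])

end Cohomology

/-- `ℤ_p / p ^ n`, with the quotient topology (which is discrete). -/
abbrev ZpMod (p : ℕ) [Fact p.Prime] (n : ℕ) : Type :=
  ℤ_[p] ⧸ Ideal.span {(p : ℤ_[p]) ^ n}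

/-- The canonical epimorphism `ℤ_p / p ^ n → ℤ_p / p ^ m` for `m ≤ n`. -/
noncomputable def ZpMod.red (p : ℕ) [Fact p.Prime] {m n : ℕ} (h : m ≤ n) :
    ZpMod p n →L[ℤ_[p]] ZpMod p m where
  toLinearMap := (Ideal.Quotient.factorₐ ℤ_[p]
    (Ideal.span_singleton_le_span_singleton.2 (pow_dvd_pow (p : ℤ_[p]) h))).toLinearMap
  cont := continuous_quot_lift _ continuous_quot_mk

/-- The pair `(G, θ)` is Kummerian if for every `n ≥ 1` the natural map
`H¹(G, ℤ_p(1) / p ^ n) → H¹(G, ℤ_p(1) / p)` is surjective. -/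
def IsKummerian (θ : G →ₜ* ℤ_[p]ˣ) : Prop :=
  ∀ (n : ℕ) (hn : 1 ≤ n), Function.Surjective (H1map θ (ZpMod.red p hn))

/-- The map `c` on `G` factors through a finitely generated quotient of `G`: there are a closed
normal subgroup `N` with `G / N` topologically finitely generated and a map `d` on `G / N` such
that `c g = d (g N)` for all `g`. -/
def FactorsThroughFGQuotient {X : Type*} (c : G → X) : Prop :=
  ∃ (N : Subgroup G) (_ : N.Normal), IsClosed (N : Set G) ∧ TopologicallyFG (G ⧸ N) ∧
    ∃ d : G ⧸ N → X, ∀ g : G, c g = d (QuotientGroup.mk g)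

end Pair

end CyclotomicProP

/-! The proof replaces cocycles with values in `ℤ_p(1)/p^n` by continuous lifts `u : G → ℤ_p` that
satisfy the cocycle identity modulo `q` (`IsCocycleMod`); `q = 0` gives genuine cocycles. Such a `u`
is a homomorphism modulo `q` on Ker θ with `u(ghg⁻¹) ≡ θ(g)u(h)`, so it vanishes modulo `q` on `K θ`
(`IsCocycleMod.K_le_zeros`). Since `G` is pro-`p`, θ ≡ 1 mod `p`. Hence coboundaries modulo `p` are
zero, and being Kummerian means that every cocycle modulo `p` lifts modulo every `p^n`; by
successive approximation it then lifts to `ℤ_p` (`exists_lift`).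

Torsion-freeness makes the image of θ procyclic, so `G` is the product of a procyclic subgroup,
generated by some `s`, and Ker θ (`exists_generator`). Therefore every cocycle `c` factors through a
quotient generated by `s` and one element of Ker θ at which `c` has minimal valuation, and the
finite generation condition in the intersection is automatic.

If mod-`p` cocycles lift and all cocycles vanish at `x`, then all cocycles modulo `p` vanish at `x`
too. A Frattini-type argument gives `x = h^p k` with `h ∈ Ker θ` and `k ∈ K θ`; then `p c(h) = 0`,
so `h` has the same property as `x`. Iterating, `x` is a `p^n`-th power modulo `K θ` for every `n`,
hence lies in the closed subgroup `K θ` (`mem_K_of_forall_eq_zero`).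

Conversely, suppose that cocycles separate points from `K θ`, and let `f` be a cocycle modulo `p`.
By compactness finitely many cocycles already detect where `f` is nonzero on Ker θ, and linear
algebra over `ℤ/p^(l+1)` writes `p^l f` on Ker θ as a combination `c` of them
(`exists_cocycle_approx`). After correction at `s`, `c` is divisible by `p^l` on all of `G`, and the
quotient, corrected at `s` again, lifts `f` (`exists_lift_of_separating`). -/

namespace CyclotomicProP

open Filter Topology

/-! ### Divisibility, limits and powers of 1-units in `ℤ_p`. -/

section Padic

variable {p : ℕ} [Fact p.Prime]

theorem isClosed_setOf_dvd (q : ℤ_[p]) : IsClosed {x : ℤ_[p] | q ∣ x} := by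
  have : {x : ℤ_[p] | q ∣ x} = (fun y => q * y) '' Set.univ := by
    ext x
    simp only [Set.mem_ofPred_eq, Set.image_univ, Set.mem_range, Dvd.dvd, eq_comm]
  rw [this]
  exact (isCompact_univ.image (by fun_prop)).isClosed

theorem isOpen_setOf_pow_dvd (n : ℕ) : IsOpen {x : ℤ_[p] | (p : ℤ_[p]) ^ n ∣ x} := by
  have : {x : ℤ_[p] | (p : ℤ_[p]) ^ n ∣ x} = Metric.closedBall 0 ((p : ℝ) ^ (-(n : ℤ))) := by
    ext x
    simp [← Ideal.mem_span_singleton, ← PadicInt.norm_le_pow_iff_mem_span_pow]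
  rw [this]
  refine IsUltrametricDist.isOpen_closedBall _ (zpow_ne_zero _ ?_)
  exact_mod_cast (Fact.out : p.Prime).ne_zero

theorem eq_zero_of_forall_pow_dvd {x : ℤ_[p]} (h : ∀ n : ℕ, (p : ℤ_[p]) ^ n ∣ x) : x = 0 := by
  by_contra hx
  obtain ⟨n, hn⟩ := FiniteMultiplicity.of_not_isUnit (PadicInt.prime_p (p := p)).not_isUnit hx
  exact hn (h _)

/-- Valuations are well-ordered, so a family has a member of least valuation. This selects all
generators below. -/
theorem exists_dvd_all {ι : Type*} [Nonempty ι] (a : ι → ℤ_[p]) : ∃ i, ∀ j, a i ∣ a j := by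
  obtain ⟨_, ⟨i, rfl⟩, hi⟩ := (wellFounded_dvdNotUnit (α := ℤ_[p])).has_min
    (Set.range a) (Set.range_nonempty a)
  refine ⟨i, fun j => (ValuationRing.dvd_total (a i) (a j)).elim id fun h => ?_⟩
  by_contra h'
  exact hi (a j) ⟨j, rfl⟩ (dvdNotUnit_of_dvd_of_not_dvd h h')

theorem exists_nat_pow_dvd_sub (a : ℤ_[p]) (n : ℕ) : ∃ j : ℕ, (p : ℤ_[p]) ^ n ∣ a - j :=
  ⟨a.appr n, Ideal.mem_span_singleton.1 (a.appr_spec n)⟩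

theorem tendsto_iff_forall_pow_dvd {α : Type*} {l : Filter α} {f : α → ℤ_[p]} {a : ℤ_[p]} :
    Tendsto f l (𝓝 a) ↔ ∀ n : ℕ, ∀ᶠ x in l, (p : ℤ_[p]) ^ n ∣ f x - a := by
  have hp : (1 : ℝ) < p := by exact_mod_cast (Fact.out : p.Prime).one_lt
  constructor
  · intro h n
    have h0 : Tendsto (fun x => f x - a) l (𝓝 0) := by simpa using h.sub_const a
    exact h0.eventually ((isOpen_setOf_pow_dvd n).mem_nhds (dvd_zero _))
  · intro h
    rw [Metric.tendsto_nhds]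
    intro ε hε
    obtain ⟨n, hn⟩ := exists_pow_lt_of_lt_one hε (inv_lt_one_of_one_lt₀ hp)
    filter_upwards [h n] with x hx
    have := (PadicInt.norm_le_pow_iff_mem_span_pow (f x - a) n).2 (Ideal.mem_span_singleton.2 hx)
    rw [dist_eq_norm]
    rw [inv_pow, ← zpow_natCast, ← zpow_neg] at hn
    exact this.trans_lt hn

theorem tendsto_of_pow_dvd_sub {a : ℤ_[p]} {f : ℕ → ℤ_[p]}
    (h : ∀ n : ℕ, (p : ℤ_[p]) ^ n ∣ a - f n) : Tendsto f atTop (𝓝 a) := by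
  refine tendsto_iff_forall_pow_dvd.2 fun n => ?_
  filter_upwards [eventually_ge_atTop n] with m hm
  rw [dvd_sub_comm]
  exact (pow_dvd_pow _ hm).trans (h m)

theorem tendsto_appr (a : ℤ_[p]) : Tendsto (fun n => (a.appr n : ℤ_[p])) atTop (𝓝 a) :=
  tendsto_of_pow_dvd_sub fun n => Ideal.mem_span_singleton.1 (a.appr_spec n)

theorem exists_limit {f : ℕ → ℤ_[p]} (h : ∀ n : ℕ, (p : ℤ_[p]) ^ n ∣ f (n + 1) - f n) :
    ∃ a, ∀ n : ℕ, (p : ℤ_[p]) ^ n ∣ a - f n := by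
  have hmono : ∀ n k : ℕ, (p : ℤ_[p]) ^ n ∣ f (n + k) - f n := by
    intro n k
    induction k with
    | zero => simp
    | succ k ih =>
      have := dvd_add ((pow_dvd_pow (p : ℤ_[p]) (Nat.le_add_right n k)).trans (h (n + k))) ih
      rwa [sub_add_sub_cancel] at this
  obtain ⟨a, φ, hφ, ha⟩ := CompactSpace.tendsto_subseq f
  refine ⟨a, fun n => ?_⟩
  refine (isClosed_setOf_dvd ((p : ℤ_[p]) ^ n)).mem_of_tendsto (ha.sub_const (f n)) ?_
  filter_upwards [eventually_ge_atTop n] with m hm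
  obtain ⟨k, hk⟩ := Nat.exists_eq_add_of_le (hm.trans (hφ.id_le m))
  change _ ∣ f (φ m) - f n
  rw [show φ m = _ from hk]
  exact hmono n k

theorem isUnit_of_not_dvd {a : ℤ_[p]} (ha : ¬ (p : ℤ_[p]) ∣ a) : IsUnit a := by
  by_contra h
  refine ha ?_
  rw [← Ideal.mem_span_singleton, ← PadicInt.maximalIdeal_eq_span_p]
  exact (IsLocalRing.mem_maximalIdeal a).2 h

theorem exists_eq_pow_mul {a : ℤ_[p]} (ha : a ≠ 0) :
    ∃ (k : ℕ) (w : ℤ_[p]), IsUnit w ∧ a = p ^ k * w := by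
  obtain ⟨k, w, hw, h⟩ :=
    WfDvdMonoid.max_power_factor ha (PadicInt.irreducible_p (p := p))
  exact ⟨k, w, isUnit_of_not_dvd hw, h⟩

/-- The binomial remainder is a multiple of `p^(2k)`, and `2k ≥ k + 2` makes it negligible against
`p^(k+1)w`. Asking for `k ≥ 2` treats `p = 2` and odd `p` alike. -/
theorem exists_one_add_pow_prime {k : ℕ} (hk : 2 ≤ k) {w : ℤ_[p]} (hw : IsUnit w) :
    ∃ w', IsUnit w' ∧ (1 + p ^ k * w) ^ p = 1 + p ^ (k + 1) * w' := by
  obtain ⟨r, hr⟩ := Polynomial.powAddExpansion (1 : ℤ_[p]) (p ^ k * w) p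
  obtain ⟨l, rfl⟩ := Nat.exists_eq_add_of_le hk
  refine ⟨w + p * (p ^ l * w ^ 2 * r), isUnit_of_not_dvd fun h => ?_, ?_⟩
  · exact PadicInt.prime_p.not_isUnit
      (isUnit_of_dvd_unit ((dvd_add_left (dvd_mul_right _ _)).1 h) hw)
  · rw [hr]
    simp only [one_pow]
    ring

theorem exists_one_add_pow_prime_pow {k : ℕ} (hk : 2 ≤ k) {w : ℤ_[p]} (hw : IsUnit w) (m : ℕ) :
    ∃ w', IsUnit w' ∧ (1 + p ^ k * w) ^ p ^ m = 1 + p ^ (k + m) * w' := by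
  induction m with
  | zero => exact ⟨w, hw, by simp⟩
  | succ m ih =>
    obtain ⟨w', hw', h⟩ := ih
    obtain ⟨w'', hw'', h'⟩ := exists_one_add_pow_prime (p := p) (k := k + m) (by omega) hw'
    exact ⟨w'', hw'', by rw [pow_succ, pow_mul, h, h', add_assoc]⟩

/-- This is density of the powers of `u` in `1 + (u - 1)ℤ_p`. As `u^(p^m)` is `1 + p^(k+m)w'` with
`w'` a unit, multiplying by a power of it corrects the approximation by one more `p`-adic digit. -/
theorem exists_pow_dvd_pow_sub {u v : ℤ_[p]} (hu : (p : ℤ_[p]) ^ 2 ∣ u - 1)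
    (huv : u - 1 ∣ v - 1) (n : ℕ) : ∃ j : ℕ, (p : ℤ_[p]) ^ n ∣ u ^ j - v := by
  rcases eq_or_ne u 1 with rfl | h1
  · rw [sub_self, zero_dvd_iff, sub_eq_zero] at huv
    exact ⟨0, by simp [huv]⟩
  obtain ⟨k, w, hw, hk⟩ := exists_eq_pow_mul (sub_ne_zero.2 h1)
  have hk2 : 2 ≤ k := by
    rw [hk, hw.dvd_mul_right] at hu
    exact (pow_dvd_pow_iff PadicInt.prime_p.ne_zero PadicInt.prime_p.not_isUnit).1 hu
  rw [hk, hw.mul_right_dvd] at huv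
  obtain rfl : u = 1 + p ^ k * w := by rw [← hk]; ring
  rcases le_total n k with hn | hn
  · exact ⟨0, by simpa [dvd_sub_comm] using (pow_dvd_pow _ hn).trans huv⟩
  obtain ⟨m, rfl⟩ := Nat.exists_eq_add_of_le hn
  clear hn
  induction m with
  | zero => exact ⟨0, by simpa [dvd_sub_comm] using huv⟩
  | succ m ih =>
    obtain ⟨j, t, ht⟩ := ih
    obtain ⟨w', hw', h⟩ := exists_one_add_pow_prime_pow (p := p) hk2 hw m
    have hunit : IsUnit (1 + p ^ k * w) := by
      refine isUnit_of_not_dvd fun h => (PadicInt.prime_p (p := p)).not_isUnit ?_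
      exact isUnit_of_dvd_one
        ((dvd_add_left ((dvd_pow_self (p : ℤ_[p]) (by omega)).mul_right _)).1 h)
    obtain ⟨e, he⟩ := (hunit.pow j).mul hw'
    -- The new error is `p^(k+m)(t + i e)` up to higher order, so `i` must satisfy `i e ≡ -t` modulo
    -- `p`.
    obtain ⟨i, s, hs⟩ := exists_nat_pow_dvd_sub (-t * ((e⁻¹ : ℤ_[p]ˣ) : ℤ_[p])) 1
    obtain ⟨r, hr⟩ := Polynomial.powAddExpansion (1 : ℤ_[p]) (p ^ (k + m) * w') i
    refine ⟨j + p ^ m * i, ?_⟩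
    obtain ⟨l, hl⟩ : ∃ l, k + m = l + 1 := ⟨k + m - 1, by omega⟩
    have hi : (i : ℤ_[p]) * e = -t - p * s * e := by
      have : (i : ℤ_[p]) = -t * ((e⁻¹ : ℤ_[p]ˣ) : ℤ_[p]) - p * s := by rw [← pow_one (p : ℤ_[p]), ← hs]; ring
      rw [this, sub_mul, mul_assoc, Units.inv_mul, mul_one]
    refine ⟨-s * e + (1 + p ^ k * w) ^ j * p ^ l * r * w' ^ 2, ?_⟩
    rw [pow_add, pow_mul, h, hr]
    have ht' : v = (1 + p ^ k * w) ^ j - p ^ (k + m) * t := by rw [← ht]; ring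
    rw [ht']
    simp only [one_pow, ← add_assoc]
    have : (p : ℤ_[p]) ^ (k + m + 1) * (-s * e + (1 + p ^ k * w) ^ j * p ^ l * r * w' ^ 2) =
      p ^ (k + m) * (-t - p * s * e + t) + (1 + p ^ k * w) ^ j * (p ^ (k + m) * p ^ (l + 1)) * r * w' ^ 2 := by ring
    rw [this, ← hi, he, ← hl]
    ring

theorem continuous_of_mul_left {X : Type*} [TopologicalSpace X] {q : ℤ_[p]} (hq : q ≠ 0)
    {f : X → ℤ_[p]} (hf : Continuous fun x => q * f x) : Continuous f := by
  have : IsClosedEmbedding (fun y : ℤ_[p] => q * y) :=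
    Continuous.isClosedEmbedding (by fun_prop) (mul_right_injective₀ hq)
  exact this.isInducing.continuous_iff.2 hf

end Padic

/-! ### Cocycles modulo `q` and the subgroup `K θ`. -/

section Cocycles

theorem tendsto_pow_of_prime_pow_dvd {p : ℕ} {G : Type*} [Group G] [TopologicalSpace G]
    [IsTopologicalGroup G] [CompactSpace G] [TotallyDisconnectedSpace G] (hG : IsProP p G) (h : G) {m : ℕ → ℕ}
    (hm : ∀ n, p ^ n ∣ m n) : Tendsto (fun n : ℕ => h ^ m n) atTop (𝓝 1) := by
  intro V hV
  obtain ⟨W, hWV, hW, h1⟩ := mem_nhds_iff.1 hV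
  obtain ⟨U, hU⟩ := ProfiniteGrp.exist_openNormalSubgroup_sub_open_nhds_of_one hW h1
  obtain ⟨k, hk⟩ := hG U.toSubgroup inferInstance U.isOpen' h
  rw [mem_map]
  filter_upwards [eventually_ge_atTop k] with n hn
  obtain ⟨l, hl⟩ := (pow_dvd_pow p hn).trans (hm n)
  refine hWV (hU ?_)
  change h ^ m n ∈ U.toSubgroup
  rw [hl, pow_mul]
  exact pow_mem hk _

variable {p : ℕ} [Fact p.Prime] {G : Type*} [Group G] [TopologicalSpace G]

/-- A continuous map `u : G → ℤ_p` which is a 1-cocycle with values in `ℤ_p(1)` modulo `q`. -/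
def IsCocycleMod (θ : G →ₜ* ℤ_[p]ˣ) (q : ℤ_[p]) (u : G → ℤ_[p]) : Prop :=
  Continuous u ∧ ∀ g h : G, q ∣ u (g * h) - (u g + θ g * u h)

namespace IsCocycleMod

variable {θ : G →ₜ* ℤ_[p]ˣ} {q : ℤ_[p]} {u v : G → ℤ_[p]}

theorem mono {r : ℤ_[p]} (hu : IsCocycleMod θ q u) (h : r ∣ q) : IsCocycleMod θ r u :=
  ⟨hu.1, fun _ _ => h.trans (hu.2 _ _)⟩

theorem of_zero (hu : IsCocycleMod θ 0 u) (q : ℤ_[p]) : IsCocycleMod θ q u :=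
  hu.mono (dvd_zero q)

theorem map_mul (hu : IsCocycleMod θ 0 u) (g h : G) : u (g * h) = u g + θ g * u h := by
  simpa [sub_eq_zero] using hu.2 g h

theorem add (hu : IsCocycleMod θ q u) (hv : IsCocycleMod θ q v) : IsCocycleMod θ q (u + v) := by
  refine ⟨hu.1.add hv.1, fun g h => ?_⟩
  have := dvd_add (hu.2 g h) (hv.2 g h)
  convert this using 1
  simp only [Pi.add_apply]
  ring

theorem const_mul (hu : IsCocycleMod θ q u) (a : ℤ_[p]) :
    IsCocycleMod θ (a * q) (fun g => a * u g) := by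
  refine ⟨continuous_const.mul hu.1, fun g h => ?_⟩
  have := mul_dvd_mul_left a (hu.2 g h)
  convert this using 1
  ring

theorem const_mul' (hu : IsCocycleMod θ q u) (a : ℤ_[p]) :
    IsCocycleMod θ q (fun g => a * u g) :=
  (hu.const_mul a).mono (dvd_mul_left _ _)

theorem sub (hu : IsCocycleMod θ q u) (hv : IsCocycleMod θ q v) :
    IsCocycleMod θ q (fun g => u g - v g) := by
  convert hu.add (hv.const_mul' (-1)) using 2
  simp [sub_eq_add_neg]

theorem sum {ι : Type*} (s : Finset ι) (f : ι → G → ℤ_[p])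
    (hf : ∀ i ∈ s, IsCocycleMod θ q (f i)) : IsCocycleMod θ q (fun g => ∑ i ∈ s, f i g) := by
  refine ⟨continuous_finsetSum s fun i hi => (hf i hi).1, fun g h => ?_⟩
  rw [Finset.mul_sum, ← Finset.sum_add_distrib, ← Finset.sum_sub_distrib]
  exact Finset.dvd_sum fun i hi => (hf i hi).2 g h

theorem of_const_mul {a : ℤ_[p]} (ha : a ≠ 0) (hu : IsCocycleMod θ (a * q) (fun g => a * u g)) :
    IsCocycleMod θ q u := by
  refine ⟨continuous_of_mul_left ha hu.1, fun g h => ?_⟩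
  rw [← mul_dvd_mul_iff_left ha]
  convert hu.2 g h using 1
  ring

theorem dvd_map_one (hu : IsCocycleMod θ q u) : q ∣ u 1 := by
  simpa using hu.2 1 1

/-- The elements on which a cocycle modulo `q` vanishes modulo `q`. -/
def zeros (hu : IsCocycleMod θ q u) : Subgroup G where
  carrier := {g | q ∣ u g}
  one_mem' := hu.dvd_map_one
  mul_mem' {g h} hg hh := by
    have := dvd_add (hu.2 g h) (dvd_add hg (hh.mul_left (θ g : ℤ_[p])))
    simpa using this
  inv_mem' {g} hg := by
    have h1 := hu.2 g⁻¹ g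
    rw [inv_mul_cancel] at h1
    have := dvd_sub (dvd_sub hu.dvd_map_one h1) (Dvd.dvd.mul_left hg (θ g⁻¹ : ℤ_[p]))
    simpa using this

theorem mem_zeros (hu : IsCocycleMod θ q u) {g : G} : g ∈ hu.zeros ↔ q ∣ u g := Iff.rfl

theorem isClosed_zeros (hu : IsCocycleMod θ q u) : IsClosed (hu.zeros : Set G) :=
  (isClosed_setOf_dvd q).preimage hu.1

theorem dvd_map_mul_sub (hu : IsCocycleMod θ q u) {g : G} (hg : θ g = 1) (h : G) :
    q ∣ u (g * h) - (u g + u h) := by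
  simpa [hg] using hu.2 g h

theorem dvd_map_pow_sub (hu : IsCocycleMod θ q u) {h : G} (hh : θ h = 1) (m : ℕ) :
    q ∣ u (h ^ m) - m * u h := by
  induction m with
  | zero => simpa using hu.dvd_map_one
  | succ m ih =>
    have := dvd_add ih (hu.dvd_map_mul_sub (g := h ^ m) (by rw [_root_.map_pow, hh, one_pow]) h)
    rw [← pow_succ] at this
    convert this using 1
    push_cast
    ring

/-- Expand `u` on `gh = (ghg⁻¹)g` in both ways. -/
theorem dvd_map_conj_sub (hu : IsCocycleMod θ q u) (g : G) {h : G} (hh : θ h = 1) :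
    q ∣ u (g * h * g⁻¹) - θ g * u h := by
  have h1 := hu.2 (g * h * g⁻¹) g
  have h2 := hu.2 g h
  have h3 : θ (g * h * g⁻¹) = 1 := by simp [hh]
  rw [h3, inv_mul_cancel_right] at h1
  have := dvd_sub h2 h1
  convert this using 1
  push_cast
  ring

variable [IsTopologicalGroup G] [CompactSpace G] [TotallyDisconnectedSpace G]

theorem dvd_map_padicPow_sub (hG : IsProP p G) (hu : IsCocycleMod θ q u) {h : G} (hh : θ h = 1)
    (a : ℤ_[p]) : q ∣ u (padicPow h a) - a * u h := by
  refine (isClosed_setOf_dvd q).mem_of_tendsto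
    (((hu.1.tendsto _).comp (tendsto_padicPow hG h a)).sub ((tendsto_appr a).mul_const (u h))) ?_
  exact Eventually.of_forall fun n => hu.dvd_map_pow_sub hh _

end IsCocycleMod

theorem mem_cocycles {θ : G →ₜ* ℤ_[p]ˣ} {u : G → ℤ_[p]} :
    u ∈ cocycles θ ℤ_[p] ↔ IsCocycleMod θ 0 u := by
  simp [cocycles, IsCocycleMod, sub_eq_zero]

variable {θ : G →ₜ* ℤ_[p]ˣ}

theorem isCocycleMod_coboundary (θ : G →ₜ* ℤ_[p]ˣ) :
    IsCocycleMod θ 0 (fun g => (θ g : ℤ_[p]) - 1) := by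
  refine ⟨(Units.continuous_val.comp θ.continuous_toFun).sub continuous_const, fun g h => ?_⟩
  simp only [map_mul, Units.val_mul, zero_dvd_iff]
  ring

theorem isClosed_ker (θ : G →ₜ* ℤ_[p]ˣ) : IsClosed {h : G | θ h = 1} :=
  isClosed_singleton.preimage θ.continuous_toFun

variable [IsTopologicalGroup G]

theorem padicPow_mem_of_isClosed [CompactSpace G] [TotallyDisconnectedSpace G] (hG : IsProP p G)
    {H : Subgroup G} (hH : IsClosed (H : Set G)) {h : G} (hh : h ∈ H) (a : ℤ_[p]) :
    padicPow h a ∈ H :=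
  hH.mem_of_tendsto (tendsto_padicPow hG h a) (Eventually.of_forall fun _ => pow_mem hh _)

theorem isClosed_K (θ : G →ₜ* ℤ_[p]ˣ) : IsClosed (K θ : Set G) :=
  Subgroup.isClosed_topologicalClosure _

theorem generator_mem_K (θ : G →ₜ* ℤ_[p]ˣ) (g : G) {h : G} (hh : θ h = 1) :
    padicPow h (-(θ g : ℤ_[p])) * g * h * g⁻¹ ∈ K θ :=
  Subgroup.le_topologicalClosure _ (Subgroup.subset_closure ⟨g, h, hh, rfl⟩)

section

variable [CompactSpace G] [TotallyDisconnectedSpace G]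

theorem theta_padicPow (hG : IsProP p G) {h : G} (hh : θ h = 1) (a : ℤ_[p]) :
    θ (padicPow h a) = 1 :=
  padicPow_mem_of_isClosed hG (H := θ.toMonoidHom.ker) (isClosed_ker θ) hh a

/-- On a generator the two contributions `-θ(g)u(h)` and `θ(g)u(h)` cancel, and the zeros form a
closed subgroup. -/
theorem IsCocycleMod.K_le_zeros (hG : IsProP p G) {q : ℤ_[p]} {u : G → ℤ_[p]}
    (hu : IsCocycleMod θ q u) : K θ ≤ hu.zeros := by
  refine Subgroup.topologicalClosure_minimal _ ?_ hu.isClosed_zeros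
  rw [Subgroup.closure_le]
  rintro _ ⟨g, h, hh, rfl⟩
  have h1 := hu.dvd_map_padicPow_sub hG hh (-(θ g : ℤ_[p]))
  have h2 := hu.dvd_map_mul_sub (theta_padicPow hG hh (-(θ g : ℤ_[p]))) (g * h * g⁻¹)
  have h3 := hu.dvd_map_conj_sub g hh
  have := dvd_add (dvd_add h1 h2) h3
  change q ∣ _
  convert this using 1
  simp only [mul_assoc]
  ring

theorem K_le_ker (hG : IsProP p G) {x : G} (hx : x ∈ K θ) : θ x = 1 := by
  have := (isCocycleMod_coboundary θ).K_le_zeros hG hx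
  rw [IsCocycleMod.mem_zeros, zero_dvd_iff, sub_eq_zero] at this
  exact Units.ext this

theorem padicPow_conj (hG : IsProP p G) (x h : G) (a : ℤ_[p]) :
    padicPow (x * h * x⁻¹) a = x * padicPow h a * x⁻¹ := by
  refine tendsto_nhds_unique (tendsto_padicPow hG _ a) ?_
  simp only [conj_pow]
  exact ((tendsto_padicPow hG h a).const_mul x).mul_const x⁻¹

theorem K_normal (hG : IsProP p G) : (K θ).Normal := by
  have : (Subgroup.closure {x : G | ∃ g h : G, θ h = 1 ∧
      x = padicPow h (-(θ g : ℤ_[p])) * g * h * g⁻¹}).Normal := by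
    refine ⟨fun y hy x => ?_⟩
    have := Subgroup.mem_map_of_mem (MulAut.conj x).toMonoidHom hy
    rw [MonoidHom.map_closure] at this
    refine Subgroup.closure_mono ?_ this
    rintro _ ⟨_, ⟨g, h, hh, rfl⟩, rfl⟩
    refine ⟨x * g * x⁻¹, x * h * x⁻¹, by simp [hh], ?_⟩
    have : θ (x * g * x⁻¹) = θ g := by
      rw [map_mul, map_mul, map_inv, mul_right_comm, mul_inv_cancel, one_mul]
    rw [this, padicPow_conj hG]
    simp [mul_assoc]
  exact Subgroup.is_normal_topologicalClosure _

theorem exists_open_normal_notMem {D : Subgroup G} (hD : IsClosed (D : Set G)) {x : G}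
    (hx : x ∉ D) : ∃ U : Subgroup G, U.Normal ∧ IsOpen (U : Set G) ∧ x ∉ D ⊔ U := by
  have hW : IsOpen ((fun y => x * y) ⁻¹' (D : Set G)ᶜ) :=
    hD.isOpen_compl.preimage (continuous_const_mul x)
  obtain ⟨U, hU⟩ := ProfiniteGrp.exist_openNormalSubgroup_sub_open_nhds_of_one hW (by simpa using hx)
  refine ⟨U.toSubgroup, inferInstance, U.isOpen', fun h => ?_⟩
  rw [← SetLike.mem_coe, Subgroup.mul_normal] at h
  obtain ⟨d, hd, v, hv, rfl⟩ := h
  exact hU (inv_mem (show v ∈ U.toSubgroup from hv)) (by simpa using hd)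

/-- By Fermat `θ(g)^(p^n) ≡ θ(g)` modulo `p` for all `n`, while `g^(p^n)` tends to `1`. -/
theorem dvd_theta_sub_one (hG : IsProP p G) (θ : G →ₜ* ℤ_[p]ˣ) (g : G) :
    (p : ℤ_[p]) ∣ θ g - 1 := by
  have h := (Units.continuous_val.tendsto _).comp
    ((θ.continuous_toFun.tendsto _).comp (tendsto_pow_of_prime_pow_dvd hG g fun n => dvd_refl (p ^ n)))
  have h2 := h.sub_const ((θ g : ℤ_[p]))
  have h3 : (p : ℤ_[p]) ∣ ((θ 1 : ℤ_[p]ˣ) : ℤ_[p]) - θ g := by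
    refine (isClosed_setOf_dvd (p : ℤ_[p])).mem_of_tendsto h2 (Eventually.of_forall fun n => ?_)
    change (p : ℤ_[p]) ∣ ((θ (g ^ p ^ n) : ℤ_[p]ˣ) : ℤ_[p]) - θ g
    rw [← Ideal.mem_span_singleton, ← PadicInt.maximalIdeal_eq_span_p, ← PadicInt.ker_toZMod,
      RingHom.mem_ker]
    simp [ZMod.pow_card_pow]
  rw [map_one, dvd_sub_comm] at h3
  simpa using h3

theorem padicPow_neg_one (hG : IsProP p G) (h : G) : padicPow h (-1 : ℤ_[p]) = h⁻¹ := by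
  rw [← mul_eq_one_iff_eq_inv]
  refine tendsto_nhds_unique ((tendsto_padicPow hG h (-1 : ℤ_[p])).mul_const h) ?_
  simp only [← pow_succ]
  refine tendsto_pow_of_prime_pow_dvd hG h fun n => ?_
  have := Ideal.mem_span_singleton.1 ((-1 : ℤ_[p]).appr_spec n)
  rw [← dvd_neg, neg_sub, sub_neg_eq_add] at this
  have h2 := (PadicInt.pow_p_dvd_int_iff (p := p) n ((-1 : ℤ_[p]).appr n + 1 : ℤ)).1
    (by exact_mod_cast this)
  exact_mod_cast h2

/-- For `θ(g) = 1` the generator of `K θ` is a commutator, so Ker θ is abelian modulo `K θ`. -/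
theorem commute_mod_K (hG : IsProP p G) {g h : G} (hg : θ g = 1) (hh : θ h = 1) :
    h⁻¹ * (g * h * g⁻¹) ∈ K θ := by
  have := generator_mem_K θ g hh
  rw [hg, Units.val_one, padicPow_neg_one hG] at this
  simpa [mul_assoc] using this

end

end Cocycles

/-! ### Power subgroups, the procyclic image of θ, and finitely generated quotients. -/

section Subgroups

/-- If `B` is commutative modulo the normal subgroup `N`, the products `b ^ n * k` with `b ∈ B` and
`k ∈ N` form a subgroup. -/
theorem exists_powSubgroup {P : Type*} [Group P] (B N : Subgroup P) [N.Normal]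
    (hB : ∀ a ∈ B, ∀ b ∈ B, b⁻¹ * (a * b * a⁻¹) ∈ N) (n : ℕ) :
    ∃ M : Subgroup P, ∀ x, x ∈ M ↔ ∃ b ∈ B, ∃ k ∈ N, x = b ^ n * k := by
  have hc : ∀ a ∈ B, ∀ b ∈ B, Commute (a : P ⧸ N) (b : P ⧸ N) := by
    intro a ha b hb
    have := (QuotientGroup.eq_one_iff _).2 (hB a ha b hb)
    rw [QuotientGroup.mk_mul, QuotientGroup.mk_inv, inv_mul_eq_one, QuotientGroup.mk_mul,
      QuotientGroup.mk_inv, eq_mul_inv_iff_mul_eq, QuotientGroup.mk_mul] at this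
    exact this.symm
  have key : ∀ x : P, (∃ b ∈ B, ∃ k ∈ N, x = b ^ n * k) ↔
      ∃ b ∈ B, (x : P ⧸ N) = (b : P ⧸ N) ^ n := by
    refine fun x => exists_congr fun b => and_congr_right fun _ => ?_
    rw [← QuotientGroup.mk_pow, eq_comm, QuotientGroup.eq]
    constructor
    · rintro ⟨k, hk, rfl⟩
      simpa using hk
    · exact fun h => ⟨_, h, by simp⟩
  refine ⟨⟨⟨⟨{x | ∃ b ∈ B, ∃ k ∈ N, x = b ^ n * k}, ?_⟩, ?_⟩, ?_⟩, fun x => Iff.rfl⟩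
  · rintro x y hx hy
    obtain ⟨b, hb, hx⟩ := (key x).1 hx
    obtain ⟨c, hc', hy⟩ := (key y).1 hy
    exact (key _).2 ⟨b * c, mul_mem hb hc', by
      rw [QuotientGroup.mk_mul, QuotientGroup.mk_mul, (hc b hb c hc').mul_pow, hx, hy]⟩
  · exact (key 1).2 ⟨1, one_mem _, by simp⟩
  · rintro x hx
    obtain ⟨b, hb, hx⟩ := (key x).1 hx
    exact (key _).2 ⟨b⁻¹, inv_mem hb, by rw [QuotientGroup.mk_inv, QuotientGroup.mk_inv, hx, inv_pow]⟩

theorem isClosed_powSubgroup {P : Type*} [Group P] [TopologicalSpace P] [IsTopologicalGroup P]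
    [CompactSpace P] [T2Space P] {B N M : Subgroup P} {n : ℕ} (hB : IsClosed (B : Set P))
    (hN : IsClosed (N : Set P)) (hM : ∀ x, x ∈ M ↔ ∃ b ∈ B, ∃ k ∈ N, x = b ^ n * k) :
    IsClosed (M : Set P) := by
  have : (M : Set P) = (fun x : P × P => x.1 ^ n * x.2) '' ((B : Set P) ×ˢ (N : Set P)) := by
    ext x
    rw [SetLike.mem_coe, hM]
    constructor
    · rintro ⟨b, hb, k, hk, rfl⟩
      exact ⟨(b, k), ⟨hb, hk⟩, rfl⟩
    · rintro ⟨⟨b, k⟩, ⟨hb, hk⟩, rfl⟩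
      exact ⟨b, hb, k, hk, rfl⟩
  rw [this]
  exact ((hB.isCompact.prod hN.isCompact).image (by fun_prop)).isClosed

theorem normal_powSubgroup {P : Type*} [Group P] {B N M : Subgroup P} [B.Normal] [N.Normal] {n : ℕ}
    (hM : ∀ x, x ∈ M ↔ ∃ b ∈ B, ∃ k ∈ N, x = b ^ n * k) : M.Normal := by
  refine ⟨fun x hx g => ?_⟩
  obtain ⟨b, hb, k, hk, rfl⟩ := (hM x).1 hx
  refine (hM _).2 ⟨g * b * g⁻¹, Subgroup.Normal.conj_mem inferInstance b hb g,
    g * k * g⁻¹, Subgroup.Normal.conj_mem inferInstance k hk g, ?_⟩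
  rw [conj_pow]
  group

theorem exists_addHom_zmod_ne_zero {p : ℕ} [Fact p.Prime] {V : Type*} [AddCommGroup V]
    [Module (ZMod p) V] {x : V} (hx : x ≠ 0) : ∃ φ : V →+ ZMod p, φ x ≠ 0 := by
  by_contra! h
  refine hx ?_
  rw [← Module.forall_dual_apply_eq_zero_iff (ZMod p) x]
  exact fun φ => h φ.toAddMonoidHom

theorem exists_hom_zmod_ne_one {p : ℕ} [Fact p.Prime] {Q : Type*} [Group Q]
    (hcomm : ∀ a b : Q, a * b = b * a) (hpow : ∀ a : Q, a ^ p = 1) {x : Q} (hx : x ≠ 1) :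
    ∃ φ : Q →* Multiplicative (ZMod p), φ x ≠ 1 := by
  let _ : CommGroup Q := { (inferInstance : Group Q) with mul_comm := hcomm }
  have hmod : Module (ZMod p) (Additive Q) := AddCommGroup.zmodModule fun a => hpow a.toMul
  obtain ⟨φ, hφ⟩ := exists_addHom_zmod_ne_zero (p := p) (x := Additive.ofMul x) hx
  exact ⟨AddMonoidHom.toMultiplicativeRight φ, hφ⟩

variable {p : ℕ} [Fact p.Prime] {G : Type*} [Group G] [TopologicalSpace G] [IsTopologicalGroup G]

/-- The closed subgroup generated by a single element. -/
abbrev procyclic (s : G) : Subgroup G := (Subgroup.zpowers s).topologicalClosure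

theorem mem_procyclic_self (s : G) : s ∈ procyclic s :=
  Subgroup.le_topologicalClosure _ (Subgroup.mem_zpowers s)

theorem isClosed_procyclic (s : G) : IsClosed (procyclic s : Set G) :=
  Subgroup.isClosed_topologicalClosure _

theorem procyclic_le {s : G} {H : Subgroup G} (hH : IsClosed (H : Set G)) (hs : s ∈ H) :
    procyclic s ≤ H :=
  Subgroup.topologicalClosure_minimal _ ((Subgroup.zpowers_le).2 hs) hH

theorem commute_of_mem_procyclic [T2Space G] {s x y : G} (hx : x ∈ procyclic s)
    (hy : y ∈ procyclic s) : Commute x y := by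
  have hs : procyclic s ≤ Subgroup.centralizer {s} :=
    procyclic_le (Set.isClosed_centralizer _) (by simp [Subgroup.mem_centralizer_iff])
  have hx' : procyclic s ≤ Subgroup.centralizer {x} := by
    refine procyclic_le (Set.isClosed_centralizer _) ?_
    have := hs hx
    rw [Subgroup.mem_centralizer_singleton_iff] at this ⊢
    exact this.symm
  exact (Subgroup.mem_centralizer_singleton_iff.1 (hx' hy)).symm

theorem exists_mem_procyclic_mul {θ : G →ₜ* ℤ_[p]ˣ} {s : G} (hs : ∀ g, ∃ y ∈ procyclic s, θ y = θ g) (g : G) :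
    ∃ y ∈ procyclic s, ∃ h, θ h = 1 ∧ g = y * h := by
  obtain ⟨y, hy, h⟩ := hs g
  exact ⟨y, hy, y⁻¹ * g, by rw [map_mul, map_inv, h, inv_mul_cancel], by simp⟩

variable [CompactSpace G] [TotallyDisconnectedSpace G] {θ : G →ₜ* ℤ_[p]ˣ}

/-- `G/D` is elementary abelian, so some homomorphism from a discrete quotient of it to `𝔽_p` is
nonzero at `x`. Such a homomorphism is a cocycle modulo `p` because θ ≡ 1 mod `p`. -/
theorem exists_notDvd_of_notMem (hG : IsProP p G) (θ : G →ₜ* ℤ_[p]ˣ) {D : Subgroup G} [D.Normal]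
    (hD : IsClosed (D : Set G)) (hpow : ∀ x, x ^ p ∈ D)
    (hcomm : ∀ a b : G, b⁻¹ * (a * b * a⁻¹) ∈ D) {x : G} (hx : x ∉ D) :
    ∃ u : G → ℤ_[p], IsCocycleMod θ p u ∧ ¬ (p : ℤ_[p]) ∣ u x := by
  obtain ⟨U, hU, hUo, hxU⟩ := exists_open_normal_notMem hD hx
  set V : Subgroup G := D ⊔ U
  have hV : IsOpen (V : Set G) := Subgroup.isOpen_mono le_sup_right hUo
  have hDV : D ≤ V := le_sup_left
  obtain ⟨φ, hφ⟩ : ∃ φ : (G ⧸ V) →* Multiplicative (ZMod p), φ (x : G ⧸ V) ≠ 1 := by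
    refine exists_hom_zmod_ne_one ?_ ?_ fun h => hxU ((QuotientGroup.eq_one_iff x).1 h)
    · rintro ⟨a⟩ ⟨b⟩
      have := (QuotientGroup.eq_one_iff _).2 (hDV (hcomm a b))
      rw [QuotientGroup.mk_mul, QuotientGroup.mk_inv, inv_mul_eq_one, QuotientGroup.mk_mul,
        QuotientGroup.mk_inv, eq_mul_inv_iff_mul_eq, QuotientGroup.mk_mul] at this
      exact this.symm
    · rintro ⟨a⟩
      exact (QuotientGroup.eq_one_iff _).2 (hDV (hpow a))
  have hker : ∀ a : ℤ_[p], (p : ℤ_[p]) ∣ a ↔ PadicInt.toZMod a = 0 := fun a => by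
    rw [← Ideal.mem_span_singleton, ← PadicInt.maximalIdeal_eq_span_p, ← PadicInt.ker_toZMod,
      RingHom.mem_ker]
  have : DiscreteTopology (G ⧸ V) := QuotientGroup.discreteTopology hV
  refine ⟨fun g => (((φ (g : G ⧸ V)).toAdd).val : ℤ_[p]), ⟨?_, fun g h => ?_⟩, ?_⟩
  · exact (continuous_of_discreteTopology (f := fun y : G ⧸ V =>
      (((φ y).toAdd).val : ℤ_[p]))).comp continuous_quot_mk
  · have hθ := (hker _).1 (dvd_theta_sub_one hG θ g)
    rw [map_sub, map_one, sub_eq_zero] at hθ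
    rw [hker]
    simp [hθ]
  · rw [hker]
    simpa using hφ

/-- Raising to the power `p` moves the values of θ into `1 + p²ℤ_p`, where the density of powers
applies even for `p = 2`. Torsion-freeness then cancels the exponent `p`. -/
theorem theta_pow_surj (hG : IsProP p G) (hθ : IsTorsionFree θ) {s : G}
    (hs : ∀ g, (θ s : ℤ_[p]) ^ p - 1 ∣ (θ g : ℤ_[p]) ^ p - 1) (g : G) :
    ∃ y ∈ procyclic s, θ y = θ g := by
  have hcont : Continuous fun y : G => (θ y : ℤ_[p]) ^ p :=
    (Units.continuous_val.comp θ.continuous_toFun).pow p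
  have hcl : IsClosed ((fun y : G => (θ y : ℤ_[p]) ^ p) '' (procyclic s : Set G)) :=
    ((isClosed_procyclic s).isCompact.image hcont).isClosed
  have hs2 : (p : ℤ_[p]) ^ 2 ∣ (θ s : ℤ_[p]) ^ p - 1 := by
    obtain ⟨t, ht⟩ := dvd_theta_sub_one hG θ s
    obtain ⟨r, hr⟩ := Polynomial.powAddExpansion (1 : ℤ_[p]) (p * t) p
    rw [sub_eq_iff_eq_add'.1 ht, hr]
    refine ⟨t + r * t ^ 2, ?_⟩
    simp only [one_pow]
    ring
  choose j hj using exists_pow_dvd_pow_sub hs2 (hs g)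
  have hlim : Tendsto (fun n => ((θ s : ℤ_[p]) ^ p) ^ j n) atTop (𝓝 ((θ g : ℤ_[p]) ^ p)) :=
    tendsto_of_pow_dvd_sub fun n => by
      rw [dvd_sub_comm]
      exact hj n
  obtain ⟨y, hy, hyg⟩ := hcl.mem_of_tendsto hlim (Eventually.of_forall fun n =>
    ⟨s ^ j n, pow_mem (mem_procyclic_self s) _, by simp [pow_right_comm]⟩)
  refine ⟨y, hy, ?_⟩
  have h1 : θ (y * g⁻¹) ^ p = 1 := by
    rw [map_mul, mul_pow, map_inv, inv_pow, mul_inv_eq_one]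
    exact Units.ext (by simpa using hyg)
  have := hθ _ ⟨_, rfl⟩ p (Fact.out : p.Prime).one_le h1
  rwa [map_mul, map_inv, mul_inv_eq_one] at this

/-- The group is the product of a procyclic subgroup and `Ker θ`, and there is a cocycle that is
trivial on `Ker θ` and takes the value `1` at the generator of the procyclic subgroup (unless this
generator is trivial). -/
theorem exists_generator (hG : IsProP p G) (hθ : IsTorsionFree θ) :
    ∃ s : G, (∀ g, ∃ y ∈ procyclic s, θ y = θ g) ∧
      ∃ d : G → ℤ_[p], IsCocycleMod θ 0 d ∧ (∀ h, θ h = 1 → d h = 0) ∧ (d s = 1 ∨ s = 1) := by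
  obtain ⟨s, hs⟩ := exists_dvd_all fun g : G => (θ g : ℤ_[p]) ^ p - 1
  have hsurj := theta_pow_surj hG hθ hs
  -- Here θ is trivial, so the procyclic factor can be taken trivial with the zero cocycle.
  -- Otherwise the cocycle is `(θ(g) - 1)/(θ(s) - 1)`.
  by_cases h1 : θ s = 1
  · have hall : ∀ g, θ g = 1 := by
      intro g
      obtain ⟨y, hy, h⟩ := hsurj g
      rw [← h]
      exact procyclic_le (H := θ.toMonoidHom.ker) (isClosed_ker θ) h1 hy
    exact ⟨1, fun g => ⟨1, one_mem _, by rw [hall, hall]⟩, 0,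
      ⟨continuous_const, fun _ _ => by simp⟩, fun _ _ => rfl, Or.inr rfl⟩
  have hne : (θ s : ℤ_[p]) - 1 ≠ 0 := fun h => h1 (Units.ext (sub_eq_zero.1 h))
  have hdvd : ∀ g, (θ s : ℤ_[p]) - 1 ∣ (θ g : ℤ_[p]) - 1 := by
    intro g
    obtain ⟨y, hy, h⟩ := hsurj g
    rw [← h]
    have hc := (isCocycleMod_coboundary θ).of_zero ((θ s : ℤ_[p]) - 1)
    exact procyclic_le hc.isClosed_zeros (s := s) (hc.mem_zeros.2 dvd_rfl) hy
  choose d hd using hdvd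
  refine ⟨s, hsurj, d, ?_, fun h hh => ?_, Or.inl ?_⟩
  · refine IsCocycleMod.of_const_mul hne ?_
    rw [mul_zero]
    simp only [← hd]
    exact isCocycleMod_coboundary θ
  · have := hd h
    rw [hh, Units.val_one, sub_self, eq_comm, mul_eq_zero] at this
    exact this.resolve_left hne
  · exact mul_left_cancel₀ hne (by rw [← hd, mul_one])

/-- Every cocycle with values in `ℤ_p(1)` factors through a finitely generated quotient. -/
theorem IsCocycleMod.factorsThroughFGQuotient (hG : IsProP p G) (hθ : IsTorsionFree θ)
    {c : G → ℤ_[p]} (hc : IsCocycleMod θ 0 c) : FactorsThroughFGQuotient c := by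
  obtain ⟨s, hs, -⟩ := exists_generator hG hθ
  let N : Subgroup G := θ.toMonoidHom.ker ⊓ hc.zeros
  have hNmem : ∀ x, x ∈ N ↔ θ x = 1 ∧ c x = 0 := fun x => by
    rw [Subgroup.mem_inf, hc.mem_zeros, zero_dvd_iff]
    rfl
  have hN : N.Normal := by
    refine ⟨fun x hx g => ?_⟩
    obtain ⟨h1, h2⟩ := (hNmem x).1 hx
    refine (hNmem _).2 ⟨by simp [h1], ?_⟩
    simpa [h2] using hc.dvd_map_conj_sub g h1
  have : Nonempty θ.toMonoidHom.ker := ⟨1⟩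
  -- `c(h)` has least valuation on Ker θ, so by compactness `c` maps the procyclic group of `h` onto
  -- `c(Ker θ)`; modulo `N`, `h` generates Ker θ.
  obtain ⟨⟨h, hh⟩, hdvd⟩ := exists_dvd_all fun h : θ.toMonoidHom.ker => c h
  have hle : procyclic h ≤ θ.toMonoidHom.ker := procyclic_le (isClosed_ker θ) hh
  have hker : ∀ x, θ x = 1 → ∃ y ∈ procyclic h, ∃ n ∈ N, x = y * n := by
    intro x hx
    obtain ⟨t, ht⟩ := hdvd ⟨x, hx⟩
    have hcl : IsClosed (c '' (procyclic h : Set G)) :=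
      ((isClosed_procyclic h).isCompact.image hc.1).isClosed
    obtain ⟨y, hy, hyx⟩ := hcl.mem_of_tendsto ((tendsto_appr t).const_mul (c h))
      (Eventually.of_forall fun n => ⟨h ^ t.appr n, pow_mem (mem_procyclic_self h) _, by
        have := hc.dvd_map_pow_sub hh (t.appr n)
        rw [zero_dvd_iff, sub_eq_zero] at this
        rw [this, mul_comm]⟩)
    have hy1 : θ y = 1 := hle hy
    refine ⟨y, hy, y⁻¹ * x, (hNmem _).2 ⟨by simp [hy1, hx], ?_⟩, by simp⟩
    have h1 := hc.map_mul y (y⁻¹ * x)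
    rw [mul_inv_cancel_left, hyx, hy1, Units.val_one, one_mul, ← ht] at h1
    simpa using h1.symm
  refine ⟨N, hN, (isClosed_ker θ).inter hc.isClosed_zeros, ?_, fun x => c x.out, fun g => ?_⟩
  · refine ⟨{(s : G ⧸ N), (h : G ⧸ N)}, by simp, ?_⟩
    set S := Subgroup.closure {(s : G ⧸ N), (h : G ⧸ N)}
    have hS : ∀ r : G, (r : G ⧸ N) ∈ S → ∀ y ∈ procyclic r, (y : G ⧸ N) ∈ S.topologicalClosure := by
      intro r hr
      exact procyclic_le (H := S.topologicalClosure.comap (QuotientGroup.mk' N))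
        ((Subgroup.isClosed_topologicalClosure S).preimage continuous_quot_mk)
        (Subgroup.le_topologicalClosure S hr)
    rintro ⟨x⟩
    obtain ⟨y, hy, k, hk, rfl⟩ := exists_mem_procyclic_mul hs x
    obtain ⟨z, hz, n, hn, rfl⟩ := hker k hk
    change ((y * (z * n) : G) : G ⧸ N) ∈ S.topologicalClosure
    rw [QuotientGroup.mk_mul, QuotientGroup.mk_mul, (QuotientGroup.eq_one_iff n).2 hn, mul_one]
    exact mul_mem (hS s (Subgroup.subset_closure (by simp)) y hy)
      (hS h (Subgroup.subset_closure (by simp)) z hz)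
  · obtain ⟨⟨n, hn⟩, h⟩ := QuotientGroup.mk_out_eq_mul N g
    change c g = c (g : G ⧸ N).out
    rw [h, hc.map_mul, ((hNmem n).1 hn).2]
    simp

end Subgroups

/-! ### Lifting cocycles to `ℤ_p`; a Kummerian pair has enough cocycles. -/

section Forward

variable {p : ℕ} [Fact p.Prime] {G : Type*} [Group G] [TopologicalSpace G] {θ : G →ₜ* ℤ_[p]ˣ}

section Lifting

/-- Lifting the reduction of `u` modulo `p` gives a `v` with `v - u = p w`, where `w` is a cocycle
to a lower modulus. Lift `w` to `w'` by induction; then `v - p w'` lifts `u`. -/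
theorem exists_lift_pow (hK : ∀ n : ℕ, 1 ≤ n → ∀ u, IsCocycleMod θ p u →
      ∃ v, IsCocycleMod θ ((p : ℤ_[p]) ^ n) v ∧ ∀ g, (p : ℤ_[p]) ∣ v g - u g) (n : ℕ)
    (u : G → ℤ_[p]) (hu : IsCocycleMod θ ((p : ℤ_[p]) ^ n) u) :
    ∃ v, IsCocycleMod θ ((p : ℤ_[p]) ^ (n + 1)) v ∧ ∀ g, (p : ℤ_[p]) ^ n ∣ v g - u g := by
  induction n generalizing u with
  | zero => exact ⟨fun _ => 0, ⟨continuous_const, fun _ _ => by simp⟩, fun g => by simp⟩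
  | succ n ih =>
    obtain ⟨v, hv, hvu⟩ := hK (n + 2) (by omega) u (hu.mono (dvd_pow_self _ (by omega)))
    choose w hw using hvu
    have hwc : IsCocycleMod θ ((p : ℤ_[p]) ^ n) w := by
      refine IsCocycleMod.of_const_mul PadicInt.prime_p.ne_zero ?_
      rw [← pow_succ']
      simp only [← hw]
      exact (hv.mono (pow_dvd_pow _ (by omega))).sub hu
    obtain ⟨w', hw', hww⟩ := ih w hwc
    refine ⟨fun g => v g - p * w' g, ?_, fun g => ?_⟩
    · have := hw'.const_mul (p : ℤ_[p])
      rw [← pow_succ'] at this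
      exact hv.sub this
    · have := mul_dvd_mul_left (p : ℤ_[p]) (hww g)
      rw [← pow_succ', ← dvd_neg] at this
      convert this using 1
      change v g - p * w' g - u g = _
      rw [← sub_add_cancel (v g) (u g), hw]
      ring

theorem exists_lift (hK : ∀ n : ℕ, 1 ≤ n → ∀ u, IsCocycleMod θ p u →
      ∃ v, IsCocycleMod θ ((p : ℤ_[p]) ^ n) v ∧ ∀ g, (p : ℤ_[p]) ∣ v g - u g)
    (u : G → ℤ_[p]) (hu : IsCocycleMod θ p u) :
    ∃ c, IsCocycleMod θ 0 c ∧ ∀ g, (p : ℤ_[p]) ∣ c g - u g := by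
  choose! F hF hF' using exists_lift_pow hK
  let f : ℕ → G → ℤ_[p] := fun n => Nat.rec u (fun n v => F (n + 1) v) n
  have hf : ∀ n, IsCocycleMod θ ((p : ℤ_[p]) ^ (n + 1)) (f n) := by
    intro n
    induction n with
    | zero =>
      change IsCocycleMod θ ((p : ℤ_[p]) ^ (0 + 1)) u
      rwa [zero_add, pow_one]
    | succ n ih => exact hF (n + 1) _ ih
  have hf' : ∀ n g, (p : ℤ_[p]) ^ (n + 1) ∣ f (n + 1) g - f n g := fun n => hF' (n + 1) _ (hf n)
  have hlim : ∀ g, ∃ a, ∀ n : ℕ, (p : ℤ_[p]) ^ n ∣ a - f n g := fun g =>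
    exists_limit fun n => (pow_dvd_pow _ n.le_succ).trans (hf' n g)
  choose c hc using hlim
  refine ⟨c, ⟨?_, fun g h => ?_⟩, fun g => ?_⟩
  · refine continuous_iff_continuousAt.2 fun g => ?_
    rw [ContinuousAt, tendsto_iff_forall_pow_dvd]
    intro n
    have h1 : ∀ᶠ x in 𝓝 g, (p : ℤ_[p]) ^ n ∣ f n x - f n g :=
      tendsto_iff_forall_pow_dvd.1 ((hf n).1.tendsto g) n
    filter_upwards [h1] with x hx
    have := dvd_add (dvd_sub hx (hc g n)) (hc x n)
    convert this using 1
    ring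
  · rw [zero_dvd_iff]
    refine eq_zero_of_forall_pow_dvd fun n => ?_
    have h1 := (pow_dvd_pow (p : ℤ_[p]) n.le_succ).trans ((hf n).2 g h)
    have := dvd_sub (dvd_add h1 (hc (g * h) n)) (dvd_add (hc g n) ((hc h n).mul_left (θ g : ℤ_[p])))
    convert this using 1
    ring
  · have := dvd_add (hc g 1) (hf' 0 g)
    simpa [f] using this

end Lifting

variable [IsTopologicalGroup G] [CompactSpace G] [TotallyDisconnectedSpace G]

/-- Since θ(g) ≡ 1 mod `p`, the element `h^(-θ(g)) h` is a limit of powers of `h^p`, so it lies in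
`M`. A generator of `K θ` then becomes `h⁻¹ghg⁻¹` modulo `M`. -/
theorem conj_mem_of_pow_mem (hG : IsProP p G) {M : Subgroup G} (hM : IsClosed (M : Set G))
    (hK : K θ ≤ M) (hpow : ∀ h, θ h = 1 → h ^ p ∈ M) (g : G) {h : G} (hh : θ h = 1) :
    h⁻¹ * (g * h * g⁻¹) ∈ M := by
  have h1 : padicPow h (-(θ g : ℤ_[p])) * h ∈ M := by
    refine hM.mem_of_tendsto ((tendsto_padicPow hG h (-(θ g : ℤ_[p]))).mul_const h) ?_
    filter_upwards [eventually_ge_atTop 1] with n hn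
    rw [← pow_succ]
    have h2 := (dvd_pow_self (p : ℤ_[p]) (by omega : n ≠ 0)).trans
      (Ideal.mem_span_singleton.1 ((-(θ g : ℤ_[p])).appr_spec n))
    have h3 := dvd_add h2 (dvd_theta_sub_one hG θ g)
    rw [← dvd_neg, show -(-(θ g : ℤ_[p]) - ((-(θ g : ℤ_[p])).appr n : ℤ_[p]) + (θ g - 1)) =
      ((((-(θ g : ℤ_[p])).appr n + 1 : ℕ) : ℤ) : ℤ_[p]) by push_cast; ring, ← pow_one (p : ℤ_[p]),
      PadicInt.pow_p_dvd_int_iff, pow_one, Int.natCast_dvd_natCast] at h3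
    obtain ⟨l, hl⟩ := h3
    rw [hl, mul_comm p l, pow_mul]
    exact hpow _ (by rw [map_pow, hh, one_pow])
  have := mul_mem (inv_mem h1) (hK (generator_mem_K θ g hh))
  simpa [mul_assoc] using this

/-- Let `M = (Ker θ)^p K θ`. Ker θ is central modulo `M` and `G` is a procyclic group times Ker θ,
so `G/M` is abelian. The hypothesis puts `x` in `D = G^p M`, say `x = y^p m`; then `θ(y)^p = 1`, and
torsion-freeness gives `y ∈ Ker θ`. -/
theorem exists_pow_mul_of_forall_dvd (hG : IsProP p G) (hθ : IsTorsionFree θ) {x : G}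
    (hx : θ x = 1) (hu : ∀ u, IsCocycleMod θ p u → (p : ℤ_[p]) ∣ u x) :
    ∃ h, θ h = 1 ∧ ∃ k ∈ K θ, x = h ^ p * k := by
  have := K_normal (θ := θ) hG
  have hker : IsClosed (θ.toMonoidHom.ker : Set G) := isClosed_ker θ
  obtain ⟨M, hM⟩ := exists_powSubgroup θ.toMonoidHom.ker (K θ)
    (fun a ha b hb => commute_mod_K hG ha hb) p
  have hMcl := isClosed_powSubgroup hker (isClosed_K θ) hM
  have hMn : M.Normal := normal_powSubgroup hM
  have hKM : K θ ≤ M := fun k hk => (hM k).2 ⟨1, one_mem _, k, hk, by simp⟩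
  have hpM : ∀ h, θ h = 1 → h ^ p ∈ M := fun h hh => (hM _).2 ⟨h, hh, 1, one_mem _, by simp⟩
  have hcen := fun g {h : G} (hh : θ h = 1) => conj_mem_of_pow_mem hG hMcl hKM hpM g hh
  have hiff : ∀ a b : G, b⁻¹ * (a * b * a⁻¹) ∈ M ↔ Commute (a : G ⧸ M) (b : G ⧸ M) := by
    intro a b
    rw [← QuotientGroup.eq_one_iff, QuotientGroup.mk_mul, QuotientGroup.mk_inv, inv_mul_eq_one,
      QuotientGroup.mk_mul, QuotientGroup.mk_inv, eq_mul_inv_iff_mul_eq, QuotientGroup.mk_mul,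
      eq_comm]
    rfl
  obtain ⟨s, hs, -⟩ := exists_generator hG hθ
  have hcomm : ∀ a b : G, b⁻¹ * (a * b * a⁻¹) ∈ M := by
    intro a b
    obtain ⟨y, hy, h, hh, rfl⟩ := exists_mem_procyclic_mul hs a
    obtain ⟨z, hz, k, hk, rfl⟩ := exists_mem_procyclic_mul hs b
    rw [hiff, QuotientGroup.mk_mul, QuotientGroup.mk_mul]
    have hyz : Commute (y : G ⧸ M) (z : G ⧸ M) :=
      (commute_of_mem_procyclic hy hz).map (QuotientGroup.mk' M)
    have hyk := (hiff y k).1 (hcen y hk)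
    have hzh := ((hiff z h).1 (hcen z hh)).symm
    have hhk := (hiff h k).1 (hcen h hk)
    exact (hyz.mul_right hyk).mul_left (hzh.mul_right hhk)
  obtain ⟨D, hD⟩ := exists_powSubgroup ⊤ M (fun a _ b _ => hcomm a b) p
  have hDcl := isClosed_powSubgroup isClosed_univ hMcl hD
  have hDn : D.Normal := normal_powSubgroup hD
  have hMD : M ≤ D := fun m hm => (hD m).2 ⟨1, trivial, m, hm, by simp⟩
  have hxD : x ∈ D := by
    by_contra h
    obtain ⟨u, hu', hux⟩ := exists_notDvd_of_notMem hG θ hDcl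
      (fun y => (hD _).2 ⟨y, trivial, 1, one_mem _, by simp⟩) (fun a b => hMD (hcomm a b)) h
    exact hux (hu u hu')
  obtain ⟨y, -, m, hm, rfl⟩ := (hD x).1 hxD
  have hθm : θ m = 1 := by
    obtain ⟨h, hh, k, hk, rfl⟩ := (hM m).1 hm
    have hh : θ h = 1 := hh
    rw [map_mul, map_pow, hh, K_le_ker hG hk, one_pow, one_mul]
  have hy : θ y = 1 := by
    rw [map_mul, hθm, mul_one, map_pow] at hx
    exact hθ _ ⟨y, rfl⟩ p (Fact.out : p.Prime).one_le hx
  exact (hM _).1 (mul_mem (hpM y hy) hm)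

theorem exists_pow_mul_of_forall_eq_zero (hG : IsProP p G) (hθ : IsTorsionFree θ)
    (hlift : ∀ u, IsCocycleMod θ p u →
      ∃ c, IsCocycleMod θ 0 c ∧ ∀ g, (p : ℤ_[p]) ∣ c g - u g)
    {x : G} (hx : ∀ c, IsCocycleMod θ 0 c → c x = 0) :
    ∃ h, (∀ c, IsCocycleMod θ 0 c → c h = 0) ∧ ∃ k ∈ K θ, x = h ^ p * k := by
  have hθx : θ x = 1 := Units.ext (sub_eq_zero.1 (hx _ (isCocycleMod_coboundary θ)))
  obtain ⟨h, hh, k, hk, rfl⟩ := exists_pow_mul_of_forall_dvd hG hθ hθx fun u hu => by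
    obtain ⟨c, hc, hcu⟩ := hlift u hu
    have := hcu x
    rwa [hx c hc, zero_sub, dvd_neg] at this
  refine ⟨h, fun c hc => ?_, k, hk, rfl⟩
  have h1 := hc.map_mul (h ^ p) k
  have h2 := hc.dvd_map_pow_sub hh p
  have h3 := hc.K_le_zeros hG hk
  rw [zero_dvd_iff, sub_eq_zero] at h2
  rw [hc.mem_zeros, zero_dvd_iff] at h3
  rw [hx c hc, h2, h3, mul_zero, add_zero, eq_comm, mul_eq_zero] at h1
  exact h1.resolve_left PadicInt.prime_p.ne_zero

theorem mem_K_of_forall_eq_zero (hG : IsProP p G) (hθ : IsTorsionFree θ)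
    (hlift : ∀ u, IsCocycleMod θ p u →
      ∃ c, IsCocycleMod θ 0 c ∧ ∀ g, (p : ℤ_[p]) ∣ c g - u g)
    {x : G} (hx : ∀ c, IsCocycleMod θ 0 c → c x = 0) : x ∈ K θ := by
  have := K_normal (θ := θ) hG
  have key : ∀ n : ℕ, ∃ h, (∀ c, IsCocycleMod θ 0 c → c h = 0) ∧
      (x : G ⧸ K θ) = (h : G ⧸ K θ) ^ p ^ n := by
    intro n
    induction n with
    | zero => exact ⟨x, hx, by simp⟩
    | succ n ih =>
      obtain ⟨h, hh, hxh⟩ := ih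
      obtain ⟨h', hh', k, hk, rfl⟩ := exists_pow_mul_of_forall_eq_zero hG hθ hlift hh
      refine ⟨h', hh', ?_⟩
      rw [hxh, QuotientGroup.mk_mul, (QuotientGroup.eq_one_iff k).2 hk, mul_one,
        QuotientGroup.mk_pow, ← pow_mul, pow_succ']
  by_contra hxK
  obtain ⟨U, hU, hUo, hxU⟩ := exists_open_normal_notMem (isClosed_K θ) hxK
  have : Finite (G ⧸ U) := U.quotient_finite_of_isOpen hUo
  have hpU : IsPGroup p (G ⧸ U) := by
    rintro ⟨g⟩
    obtain ⟨k, hk⟩ := hG U hU hUo g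
    exact ⟨k, (QuotientGroup.eq_one_iff (N := U) (g ^ p ^ k)).2 hk⟩
  -- With `p^n` the order of `G/U`, every `p^n`-th power lies in `U`, so `x ∈ K θ · U`.
  obtain ⟨n, hn⟩ := IsPGroup.iff_card.1 hpU
  obtain ⟨h, -, hxh⟩ := key n
  rw [← QuotientGroup.mk_pow, eq_comm, QuotientGroup.eq] at hxh
  have hhU : h ^ p ^ n ∈ U := by
    rw [← QuotientGroup.eq_one_iff, QuotientGroup.mk_pow, ← hn, pow_card_eq_one']
  refine hxU ?_
  have := mul_mem ((le_sup_right : U ≤ K θ ⊔ U) hhU) ((le_sup_left : K θ ≤ K θ ⊔ U) hxh)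
  simpa using this

end Forward

/-! ### Linear algebra modulo `p^n`; enough cocycles make the pair Kummerian. -/

section Backward

section HomMod

variable {R X : Type*} [CommRing R] [Group X]

/-- The map `s` is, on the subgroup `H`, a homomorphism modulo `q`. -/
def IsHomMod (H : Subgroup X) (q : R) (s : X → R) : Prop :=
  ∀ x ∈ H, ∀ y ∈ H, q ∣ s (x * y) - (s x + s y)

namespace IsHomMod

variable {H : Subgroup X} {q : R} {s f : X → R}

theorem dvd_map_one (hs : IsHomMod H q s) : q ∣ s 1 := by
  simpa using hs 1 (one_mem H) 1 (one_mem H)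

theorem mono {H' : Subgroup X} (hs : IsHomMod H q s) (h : H' ≤ H) : IsHomMod H' q s :=
  fun x hx y hy => hs x (h hx) y (h hy)

theorem dvd_map_pow_sub (hs : IsHomMod H q s) {x : X} (hx : x ∈ H) (m : ℕ) :
    q ∣ s (x ^ m) - m * s x := by
  induction m with
  | zero => simpa using hs.dvd_map_one
  | succ m ih =>
    have := dvd_add ih (hs (x ^ m) (pow_mem hx m) x hx)
    rw [← pow_succ] at this
    convert this using 1
    push_cast
    ring

/-- The elements of `H` on which a homomorphism modulo `q` vanishes modulo `q`. -/
def zeros (hs : IsHomMod H q s) : Subgroup X where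
  carrier := {x | x ∈ H ∧ q ∣ s x}
  one_mem' := ⟨one_mem H, hs.dvd_map_one⟩
  mul_mem' {x y} hx hy := ⟨mul_mem hx.1 hy.1, by
    simpa using dvd_add (hs x hx.1 y hy.1) (dvd_add hx.2 hy.2)⟩
  inv_mem' {x} hx := ⟨inv_mem hx.1, by
    have h1 := hs x⁻¹ (inv_mem hx.1) x hx.1
    rw [inv_mul_cancel] at h1
    simpa using dvd_sub (dvd_sub hs.dvd_map_one h1) hx.2⟩

theorem sub (hf : IsHomMod H q f) (hs : IsHomMod H q s) : IsHomMod H q (fun x => f x - s x) := by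
  intro x hx y hy
  have := dvd_sub (hf x hx y hy) (hs x hx y hy)
  convert this using 1
  ring

theorem sum {ι : Type*} (t : Finset ι) {s : ι → X → R} (hs : ∀ i ∈ t, IsHomMod H q (s i))
    (k : ι → R) : IsHomMod H q (fun x => ∑ i ∈ t, k i * s i x) := by
  intro x hx y hy
  rw [← Finset.sum_add_distrib, ← Finset.sum_sub_distrib]
  refine Finset.dvd_sum fun i hi => ?_
  rw [← mul_add, ← mul_sub]
  exact (hs i hi x hx y hy).mul_left _

end IsHomMod

variable {p : ℕ} [Fact p.Prime] {H : Subgroup X} {n : ℕ} {f : X → ℤ_[p]}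

/-- Choose `x₀` with `s(x₀)` of least valuation `k`. If `k < n`, or `k = n - l` in general, then `s`
kills `x₀^(p^l)` modulo `p^n`, hence so does `f`, and `p^k` divides `f(x₀)`. The factor is `m =
f(x₀)/s(x₀)`, because each `x` is a power of `x₀` up to a zero of `s`. -/
theorem IsHomMod.exists_mul {s : X → ℤ_[p]} (hs : IsHomMod H ((p : ℤ_[p]) ^ n) s)
    (hf : IsHomMod H ((p : ℤ_[p]) ^ n) f)
    (hsf : ∀ x ∈ H, (p : ℤ_[p]) ^ n ∣ s x → (p : ℤ_[p]) ^ n ∣ f x) :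
    ∃ m, ∀ x ∈ H, (p : ℤ_[p]) ^ n ∣ f x - m * s x := by
  obtain ⟨⟨x₀, h₀⟩, hdvd⟩ := exists_dvd_all fun x : H => s x
  replace hdvd : ∀ x ∈ H, s x₀ ∣ s x := fun x hx => hdvd ⟨x, hx⟩
  by_cases hq : (p : ℤ_[p]) ^ n ∣ s x₀
  · exact ⟨0, fun x hx => by simpa using hsf x hx (hq.trans (hdvd x hx))⟩
  have hne : s x₀ ≠ 0 := fun h => hq (h ▸ dvd_zero _)
  obtain ⟨k, w, hw, hk⟩ := exists_eq_pow_mul hne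
  have hkn : k ≤ n := by
    by_contra! h
    exact hq (hk ▸ (pow_dvd_pow _ h.le).mul_right _)
  obtain ⟨l, rfl⟩ := Nat.exists_eq_add_of_le hkn
  have h1 : (p : ℤ_[p]) ^ (k + l) ∣ ((p ^ l : ℕ) : ℤ_[p]) * f x₀ := by
    rw [← dvd_iff_dvd_of_dvd_sub (hf.dvd_map_pow_sub h₀ (p ^ l))]
    refine hsf _ (pow_mem h₀ _) ?_
    rw [dvd_iff_dvd_of_dvd_sub (hs.dvd_map_pow_sub h₀ (p ^ l)), hk]
    exact ⟨w, by push_cast; ring⟩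
  obtain ⟨m, hm⟩ : s x₀ ∣ f x₀ := by
    rw [hk, hw.mul_right_dvd]
    rw [add_comm, pow_add, Nat.cast_pow] at h1
    exact (mul_dvd_mul_iff_left (pow_ne_zero l PadicInt.prime_p.ne_zero)).1 h1
  refine ⟨m, fun x hx => ?_⟩
  obtain ⟨t, ht⟩ := hdvd x hx
  obtain ⟨j, hj⟩ := exists_nat_pow_dvd_sub t (k + l)
  have hy : x * (x₀ ^ j)⁻¹ ∈ H := mul_mem hx (inv_mem (pow_mem h₀ j))
  have hs1 := hs _ hy _ (pow_mem h₀ j)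
  have hf1 := hf _ hy _ (pow_mem h₀ j)
  rw [inv_mul_cancel_right] at hs1 hf1
  have hsy : (p : ℤ_[p]) ^ (k + l) ∣ s (x * (x₀ ^ j)⁻¹) := by
    have := dvd_sub (dvd_sub (hj.mul_left (s x₀)) hs1) (hs.dvd_map_pow_sub h₀ j)
    rw [ht] at this
    convert this using 1
    ring
  have := dvd_add (dvd_add (dvd_add hf1 (hsf _ hy hsy)) (hf.dvd_map_pow_sub h₀ j))
    (hj.mul_left (-(s x₀ * m)))
  rw [hm] at this
  rw [ht]
  convert this using 1
  ring

/-- If a homomorphism modulo `p ^ n` vanishes on the common zeros of finitely many others, it is a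
linear combination of them. -/
theorem IsHomMod.exists_sum {ι : Type*} (t : Finset ι) {s : ι → X → ℤ_[p]}
    (hs : ∀ i ∈ t, IsHomMod H ((p : ℤ_[p]) ^ n) (s i)) (hf : IsHomMod H ((p : ℤ_[p]) ^ n) f)
    (hsf : ∀ x ∈ H, (∀ i ∈ t, (p : ℤ_[p]) ^ n ∣ s i x) → (p : ℤ_[p]) ^ n ∣ f x) :
    ∃ k : ι → ℤ_[p], ∀ x ∈ H, (p : ℤ_[p]) ^ n ∣ f x - ∑ i ∈ t, k i * s i x := by
  classical
  induction t using Finset.induction_on generalizing H with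
  | empty => exact ⟨0, fun x hx => by simpa using hsf x hx (by simp)⟩
  | insert a t ha ih =>
    have hsa := hs a (Finset.mem_insert_self a t)
    have hst : ∀ i ∈ t, IsHomMod H ((p : ℤ_[p]) ^ n) (s i) :=
      fun i hi => hs i (Finset.mem_insert_of_mem hi)
    have hle : hsa.zeros ≤ H := fun x hx => hx.1
    -- The induction runs over the subgroup where `s a` vanishes; there `f` is a combination of the
    -- others, and the difference is a multiple of `s a` on all of `H`.
    obtain ⟨k, hk⟩ := ih (fun i hi => (hst i hi).mono hle) (hf.mono hle) fun x hx h =>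
      hsf x hx.1 fun i hi => by
        rcases Finset.mem_insert.1 hi with rfl | hi
        · exact hx.2
        · exact h i hi
    obtain ⟨m, hm⟩ := hsa.exists_mul (hf.sub (IsHomMod.sum t hst k)) fun x hx h => hk x ⟨hx, h⟩
    refine ⟨Function.update k a m, fun x hx => ?_⟩
    rw [Finset.sum_insert ha, Function.update_self, Finset.sum_congr rfl fun i hi => by
      rw [Function.update_of_ne (ne_of_mem_of_not_mem hi ha)]]
    have := hm x hx
    convert this using 1
    ring

end HomMod

variable {p : ℕ} [Fact p.Prime] {G : Type*} [Group G] [TopologicalSpace G] {θ : G →ₜ* ℤ_[p]ˣ}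

theorem IsCocycleMod.isHomMod {q : ℤ_[p]} {u : G → ℤ_[p]} (hu : IsCocycleMod θ q u) :
    IsHomMod θ.toMonoidHom.ker q u :=
  fun _ hx y _ => hu.dvd_map_mul_sub hx y

theorem discreteTopology_zpMod (p : ℕ) [Fact p.Prime] (n : ℕ) : DiscreteTopology (ZpMod p n) := by
  refine QuotientAddGroup.discreteTopology (N := (Ideal.span {(p : ℤ_[p]) ^ n}).toAddSubgroup) ?_
  convert isOpen_setOf_pow_dvd (p := p) n using 1
  ext x
  exact Ideal.mem_span_singleton

theorem mk_eq_mk_iff_dvd {n : ℕ} {x y : ℤ_[p]} :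
    (Ideal.Quotient.mk (Ideal.span {(p : ℤ_[p]) ^ n}) x : ZpMod p n) =
      Ideal.Quotient.mk (Ideal.span {(p : ℤ_[p]) ^ n}) y ↔ (p : ℤ_[p]) ^ n ∣ x - y := by
  rw [Ideal.Quotient.eq, Ideal.mem_span_singleton]

theorem IsCocycleMod.mk_mem_cocycles {n : ℕ} {u : G → ℤ_[p]}
    (hu : IsCocycleMod θ ((p : ℤ_[p]) ^ n) u) :
    (fun g => (Ideal.Quotient.mk (Ideal.span {(p : ℤ_[p]) ^ n}) (u g) : ZpMod p n)) ∈
      cocycles θ (ZpMod p n) := by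
  refine ⟨continuous_quot_mk.comp hu.1, fun g h => ?_⟩
  exact mk_eq_mk_iff_dvd.2 (hu.2 g h)

theorem exists_isCocycleMod {n : ℕ} {c : G → ZpMod p n} (hc : c ∈ cocycles θ (ZpMod p n)) :
    ∃ u, IsCocycleMod θ ((p : ℤ_[p]) ^ n) u ∧
      ∀ g, c g = Ideal.Quotient.mk (Ideal.span {(p : ℤ_[p]) ^ n}) (u g) := by
  have := discreteTopology_zpMod p n
  have hout : ∀ x : ZpMod p n, Ideal.Quotient.mk (Ideal.span {(p : ℤ_[p]) ^ n})
      (Function.surjInv Ideal.Quotient.mk_surjective x) = x :=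
    Function.surjInv_eq Ideal.Quotient.mk_surjective
  refine ⟨fun g => Function.surjInv Ideal.Quotient.mk_surjective (c g),
    ⟨(continuous_of_discreteTopology (f := Function.surjInv (Ideal.Quotient.mk_surjective
      (I := Ideal.span {(p : ℤ_[p]) ^ n})))).comp hc.1, fun g h => ?_⟩, fun g => (hout _).symm⟩
  rw [← mk_eq_mk_iff_dvd, map_add, map_mul, hout, hout, hout, hc.2]
  rfl

theorem red_mk {m n : ℕ} (h : m ≤ n) (x : ℤ_[p]) :
    ZpMod.red p h (Ideal.Quotient.mk (Ideal.span {(p : ℤ_[p]) ^ n}) x) =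
      Ideal.Quotient.mk (Ideal.span {(p : ℤ_[p]) ^ m}) x := rfl

theorem isKummerian_of_lift
    (hlift : ∀ u, IsCocycleMod θ p u → ∃ c, IsCocycleMod θ 0 c ∧ ∀ g, (p : ℤ_[p]) ∣ c g - u g) :
    IsKummerian θ := by
  intro n hn x
  obtain ⟨⟨c, hc⟩, rfl⟩ := QuotientAddGroup.mk_surjective x
  obtain ⟨u, hu, hcu⟩ := exists_isCocycleMod hc
  rw [pow_one] at hu
  obtain ⟨v, hv, hvu⟩ := hlift u hu
  refine ⟨QuotientAddGroup.mk ⟨_, (hv.of_zero ((p : ℤ_[p]) ^ n)).mk_mem_cocycles⟩, ?_⟩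
  refine congrArg QuotientAddGroup.mk (Subtype.ext (funext fun g => ?_))
  change ZpMod.red p hn (Ideal.Quotient.mk _ (v g)) = c g
  rw [hcu, red_mk, mk_eq_mk_iff_dvd, pow_one]
  exact hvu g

variable [IsTopologicalGroup G] [CompactSpace G] [TotallyDisconnectedSpace G]

/-- On the kernel of `θ`, a multiple of a cocycle modulo `p` is a combination of cocycles, when these
separate the points outside `K`. -/
theorem exists_cocycle_approx (hG : IsProP p G)
    (hsep : ∀ x, x ∉ K θ → ∃ c, IsCocycleMod θ 0 c ∧ c x ≠ 0) {f : G → ℤ_[p]}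
    (hf : IsCocycleMod θ p f) :
    ∃ (l : ℕ) (c : G → ℤ_[p]), IsCocycleMod θ 0 c ∧
      ∀ x, θ x = 1 → (p : ℤ_[p]) ^ (l + 1) ∣ p ^ l * f x - c x := by
  let Y : Set G := {x | θ x = 1 ∧ ¬ (p : ℤ_[p]) ∣ f x}
  have hY : IsCompact Y := by
    have h1 := (isOpen_setOf_pow_dvd (p := p) 1).preimage hf.1
    simp only [pow_one] at h1
    exact ((isClosed_ker θ).inter h1.isClosed_compl).isCompact
  obtain ⟨t, ht⟩ := hY.elim_finite_subcover
    (fun i : {c : G → ℤ_[p] // IsCocycleMod θ 0 c} × ℕ => {x | ¬ (p : ℤ_[p]) ^ i.2 ∣ i.1.1 x})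
    (fun i => ((isClosed_setOf_dvd _).preimage i.1.2.1).isOpen_compl) (by
      rintro x ⟨-, hx⟩
      obtain ⟨c, hc, hcx⟩ := hsep x fun h => hx (hf.K_le_zeros hG h)
      obtain ⟨n, hn⟩ : ∃ n : ℕ, ¬ (p : ℤ_[p]) ^ n ∣ c x := by
        by_contra! h
        exact hcx (eq_zero_of_forall_pow_dvd h)
      exact Set.mem_iUnion.2 ⟨(⟨c, hc⟩, n), hn⟩)
  -- If all chosen cocycles vanish at `x ∈ Ker θ` modulo `p^(l+1)`, then `x` is outside the cover of
  -- `Y`, so `p` divides `f(x)`. Scaling by `p^l` turns this into a statement modulo `p^(l+1)`,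
  -- where `p^l f` is a homomorphism on Ker θ.
  let l := t.sup Prod.snd
  obtain ⟨k, hk⟩ := IsHomMod.exists_sum (H := θ.toMonoidHom.ker) (n := l + 1) t
    (s := fun i => i.1.1) (f := fun x => (p : ℤ_[p]) ^ l * f x) (fun i _ => (i.1.2.of_zero _).isHomMod)
    (by
      have := hf.const_mul ((p : ℤ_[p]) ^ l)
      rw [← pow_succ] at this
      exact this.isHomMod)
    (fun x hx h => by
      rw [pow_succ]
      refine mul_dvd_mul_left _ ?_
      by_contra hfx
      obtain ⟨i, hi, hix⟩ := Set.mem_iUnion₂.1 (ht ⟨hx, hfx⟩)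
      exact hix ((pow_dvd_pow _ ((Finset.le_sup hi).trans l.le_succ)).trans (h i hi)))
  exact ⟨l, fun x => ∑ i ∈ t, k i * i.1.1 x,
    IsCocycleMod.sum t (fun i x => k i * i.1.1 x) fun i _ => i.1.2.const_mul' _, hk⟩

theorem exists_lift_of_separating (hG : IsProP p G) (hθ : IsTorsionFree θ)
    (hsep : ∀ x, x ∉ K θ → ∃ c, IsCocycleMod θ 0 c ∧ c x ≠ 0) {f : G → ℤ_[p]}
    (hf : IsCocycleMod θ p f) :
    ∃ c, IsCocycleMod θ 0 c ∧ ∀ g, (p : ℤ_[p]) ∣ c g - f g := by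
  obtain ⟨l, c, hc, hcf⟩ := exists_cocycle_approx hG hsep hf
  obtain ⟨s, hs, d, hd, hd0, hds⟩ := exists_generator hG hθ
  have hpl : (p : ℤ_[p]) ^ l ≠ 0 := pow_ne_zero l PadicInt.prime_p.ne_zero
  -- Subtracting a multiple of `d` makes the cocycle vanish at `s` without changing it on Ker θ,
  -- where it is divisible by `p^l`; it is then divisible by `p^l` everywhere.
  have hc0 : IsCocycleMod θ 0 (fun g => c g - c s * d g) := hc.sub (hd.const_mul' _)
  have hc0s : c s - c s * d s = 0 := by
    rcases hds with h | rfl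
    · rw [h, mul_one, sub_self]
    · simpa using hc0.dvd_map_one
  have hdvd : ∀ g, (p : ℤ_[p]) ^ l ∣ c g - c s * d g := by
    intro g
    have hcl := hc0.of_zero ((p : ℤ_[p]) ^ l)
    change g ∈ hcl.zeros
    obtain ⟨y, hy, h, hh, rfl⟩ := exists_mem_procyclic_mul hs g
    refine mul_mem (procyclic_le hcl.isClosed_zeros (hcl.mem_zeros.2 ?_) hy) (hcl.mem_zeros.2 ?_)
    · rw [hc0s]
      exact dvd_zero _
    · rw [hd0 h hh, mul_zero, sub_zero]
      have := dvd_sub (dvd_mul_right ((p : ℤ_[p]) ^ l) (f h))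
        ((pow_dvd_pow _ l.le_succ).trans (hcf h hh))
      rwa [sub_sub_cancel] at this
  choose c₁ hc₁ using hdvd
  have hc₁' : IsCocycleMod θ 0 c₁ := by
    refine IsCocycleMod.of_const_mul hpl ?_
    rw [mul_zero]
    simpa only [← hc₁] using hc0
  have hc₁f : ∀ h, θ h = 1 → (p : ℤ_[p]) ∣ c₁ h - f h := by
    intro h hh
    have h1 := hcf h hh
    have h2 := hc₁ h
    rw [hd0 h hh, mul_zero, sub_zero] at h2
    rw [h2, ← mul_sub, pow_succ, mul_dvd_mul_iff_left hpl] at h1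
    rwa [dvd_sub_comm]
  -- A second multiple of `d` enforces agreement with `f` at `s`; agreement modulo `p` at `s` and on
  -- Ker θ suffices.
  have hc₂ : IsCocycleMod θ 0 (fun g => c₁ g - (c₁ s - f s) * d g) := hc₁'.sub (hd.const_mul' _)
  refine ⟨_, hc₂, fun g => ?_⟩
  have he := (hc₂.of_zero p).sub hf
  change g ∈ he.zeros
  obtain ⟨y, hy, h, hh, rfl⟩ := exists_mem_procyclic_mul hs g
  refine mul_mem (procyclic_le he.isClosed_zeros ?_ hy) (he.mem_zeros.2 ?_)
  · rcases hds with h | rfl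
    · rw [he.mem_zeros, h]
      simp
    · exact one_mem _
  · simpa [hd0 h hh] using hc₁f h hh

/-- Coboundaries modulo `p` vanish because θ ≡ 1 mod `p`, so equality of classes is equality of
cocycles. -/
theorem exists_mod_lift_of_isKummerian (hG : IsProP p G) (hK : IsKummerian θ) (n : ℕ) (hn : 1 ≤ n)
    (u : G → ℤ_[p]) (hu : IsCocycleMod θ p u) :
    ∃ v, IsCocycleMod θ ((p : ℤ_[p]) ^ n) v ∧ ∀ g, (p : ℤ_[p]) ∣ v g - u g := by
  rw [← pow_one (p : ℤ_[p])] at hu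
  obtain ⟨x, hx⟩ := hK n hn (QuotientAddGroup.mk ⟨_, hu.mk_mem_cocycles⟩)
  obtain ⟨⟨c, hc⟩, rfl⟩ := QuotientAddGroup.mk_surjective x
  obtain ⟨v, hv, hcv⟩ := exists_isCocycleMod hc
  refine ⟨v, hv, fun g => ?_⟩
  have h1 := QuotientAddGroup.eq.1 hx
  obtain ⟨m, hm⟩ := h1
  have h2 := hm g
  obtain ⟨m, rfl⟩ := Ideal.Quotient.mk_surjective m
  have h3 : (θ g : ℤ_[p]) • (Ideal.Quotient.mk (Ideal.span {(p : ℤ_[p]) ^ 1}) m : ZpMod p 1) -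
      Ideal.Quotient.mk _ m = 0 := by
    have h4 : (p : ℤ_[p]) ^ 1 ∣ θ g * m - m := by
      have := (dvd_theta_sub_one hG θ g).mul_right m
      rwa [sub_mul, one_mul, ← pow_one (p : ℤ_[p])] at this
    exact sub_eq_zero.2 (mk_eq_mk_iff_dvd.2 h4)
  rw [h3] at h2
  have h5 : -(ZpMod.red p hn (c g)) + Ideal.Quotient.mk (Ideal.span {(p : ℤ_[p]) ^ 1}) (u g) = 0 :=
    h2
  rw [hcv, red_mk, neg_add_eq_zero, mk_eq_mk_iff_dvd, pow_one] at h5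
  exact h5

end Backward

end CyclotomicProP

theorem theorem6p13 (p : ℕ) [Fact p.Prime] (G : Type*) [Group G] [TopologicalSpace G]
    [IsTopologicalGroup G] [CompactSpace G] [TotallyDisconnectedSpace G]
    (hG : CyclotomicProP.IsProP p G) (θ : G →ₜ* ℤ_[p]ˣ)
    (hθ : CyclotomicProP.IsTorsionFree θ) :
    CyclotomicProP.IsKummerian θ ↔
      (CyclotomicProP.K θ : Set G) =
        ⋂ c ∈ {c : G → ℤ_[p] | c ∈ CyclotomicProP.cocycles θ ℤ_[p] ∧
          CyclotomicProP.FactorsThroughFGQuotient c}, c ⁻¹' {0} := by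
  have hmem : ∀ x, (x ∈ ⋂ c ∈ {c : G → ℤ_[p] | c ∈ CyclotomicProP.cocycles θ ℤ_[p] ∧
      CyclotomicProP.FactorsThroughFGQuotient c}, c ⁻¹' {0}) ↔
      ∀ c, CyclotomicProP.IsCocycleMod θ 0 c → c x = 0 := by
    intro x
    simp only [Set.mem_iInter]
    exact ⟨fun h c hc => h c ⟨CyclotomicProP.mem_cocycles.2 hc, hc.factorsThroughFGQuotient hG hθ⟩,
      fun h c hc => h c (CyclotomicProP.mem_cocycles.1 hc.1)⟩
  constructor
  · intro hK
    ext x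
    rw [hmem]
    refine ⟨fun hx c hc => ?_, fun hx => CyclotomicProP.mem_K_of_forall_eq_zero hG hθ
      (CyclotomicProP.exists_lift (CyclotomicProP.exists_mod_lift_of_isKummerian hG hK)) hx⟩
    exact zero_dvd_iff.1 (hc.mem_zeros.1 (hc.K_le_zeros hG hx))
  · intro hK
    refine CyclotomicProP.isKummerian_of_lift fun u hu =>
      CyclotomicProP.exists_lift_of_separating hG hθ (fun x hx => ?_) hu
    rw [← SetLike.mem_coe, hK, hmem] at hx
    push Not at hx
    exact hx
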